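/- For a finite tree $T$, a $T$-matching is a graph all of whose connected components are isomorphic to $T$; an induced $T$-matching in a graph $G$ is an induced subgraph of $G$ that is a $T$-matching, and its order is its number of vertices. Let $G(n,p)$ be the binomial random graph on $n$ vertices with edge probability $p$. Theorem. For every $\varepsilon>0$ and every finite tree $T$ there exists $d_0=d_0(\varepsilon,T)>0$ such that the following holds. Let $p=p(n)\in[0,1]$ be any sequence with $\frac{d_0}{n}\le p(n)\le 0.99$ for all sufficiently large $n$, and let $q=q(n)=\frac{1}{1-p(n)}$. Then, with probability tending to $1$ as $n\to\infty$, the maximum order $X$ of an induced $T$-matching in $G(n,p)$ satisfies $$(2-\varepsilon)\log_q(np)\;\le\; X\;\le\;(2+\varepsilon)\log_q(np).$$ -/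

import Mathlib

open Filter Topology
open scoped SimpleGraph

/-- `H` is a `T`-matching: every connected component of `H`, as a graph on its own vertex set, is
isomorphic to `T`. (The graph without vertices is a `T`-matching of order `0`.) -/
def SimpleGraph.IsTMatching {V W : Type*} (T : SimpleGraph W) (H : SimpleGraph V) : Prop :=
  ∀ C : H.ConnectedComponent, Nonempty (C.toSimpleGraph ≃g T)

/-- The orders (numbers of vertices) of the induced `T`-matchings in `G`, that is, of the vertex
sets whose induced subgraph is a `T`-matching. -/
def SimpleGraph.inducedTMatchingOrders {V W : Type*} (T : SimpleGraph W) (G : SimpleGraph V) :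
    Set ℕ :=
  {k | ∃ S : Set V, IsTMatching T (G.induce S) ∧ S.ncard = k}

/-- The order of a largest induced `T`-matching in `G`. It is used for graphs with finitely many
vertices only, where the supremum is a maximum, by the lemma below. -/
noncomputable def SimpleGraph.maxInducedTMatchingOrder {V W : Type*} (T : SimpleGraph W)
    (G : SimpleGraph V) : ℕ :=
  sSup (inducedTMatchingOrders T G)

theorem SimpleGraph.isGreatest_maxInducedTMatchingOrder {V W : Type*} [Finite V]
    (T : SimpleGraph W) (G : SimpleGraph V) :
    IsGreatest (inducedTMatchingOrders T G) (maxInducedTMatchingOrder T G) := by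
  have hne : (inducedTMatchingOrders T G).Nonempty := by
    refine ⟨0, ∅, fun C => ?_, Set.ncard_empty V⟩
    obtain ⟨v, _⟩ := C.exists_rep
    exact absurd v.2 (Set.notMem_empty _)
  have hbdd : BddAbove (inducedTMatchingOrders T G) := by
    refine ⟨Nat.card V, ?_⟩
    rintro k ⟨S, _, rfl⟩
    exact Set.ncard_le_card S
  exact ⟨Nat.sSup_mem hne hbdd, fun k hk => le_csSup hbdd hk⟩

/-!
# The largest induced `T`-matching in a binomial random graph

Write `d = n p`, `q = 1 / (1 - p)`, `L = log_q d` and `t = |T|`.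

*Upper bound.* Every set of `x` vertices inside an induced `T`-matching spans a forest, hence at most
`x` edges. A fixed set does so with probability at most `(C x p) ^ x * q ^ (-x ^ 2 / 2)`, by a
Chernoff bound, and there are at most `(e n / x) ^ x` sets. The product is
`(C' * d * q ^ (-x / 2)) ^ x`, which is exponentially small once `x ≥ (2 + ε) L` and `d` is large
(`binomialRandom_real_le_maxInducedTMatchingOrder_le`, `choose_mul_pow_le`).

*Lower bound.* Let `k = m t` be slightly below `2 L`. The vertices are divided into `2 k` blocks, and
only placements of `m` copies of `T` are considered that use each block at most once. In the second
moment of the number of induced such placements, the pairs with `i` common vertices contribute, in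
proportion to the square of the first moment, at most `choose k i * (C k / n) ^ i * q ^ (i ^ 2 / 2)`:
a common edge gains a factor `1 / p`, but the leaf removal argument `card_pow_mul_sum_pow_le` shows
that this is made up for by the loss of choice, because `k p` is bounded below. Each such term is at
most `exp (δ k)`, so an induced placement of all `m` copies exists with probability at least
`exp (-2 δ k)` (`one_div_le_binomialRandom_real_iUnion`, `sum_choose_mul_pow_le`). This need not be
close to `1` when `p` is of order `1 / n`. However, the largest number of copies in a transversal
induced `T`-matching changes by at most `1` when only edges whose later block is a given one are
changed, and there are only `2 k` blocks. So the bounded differences inequality, in the product form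
`measure_pi_ge_mul_measure_pi_le_le`, bounds the product of the probability of having `m` copies and
that of having at most `(1 - a) m` copies by `exp (-c a ^ 2 k)`. With `δ` small compared with
`c a ^ 2`, the latter probability tends to `0`. The use of blocks makes the argument uniform in `p`:
with one coordinate for each of the `n` vertices the bound would be too weak.
-/

open MeasureTheory ProbabilityTheory

/-! ### Concentration for Lipschitz functions on product spaces -/

theorem ENNReal.mul_inv_add_mul_inv_le {a b : ENNReal} {c : ℝ} (hc : 0 < c)
    (ha : a ≠ 0) (ha' : a ≠ ⊤) (hb : b ≠ 0) (hb' : b ≠ ⊤)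
    (hab : a ≤ ENNReal.ofReal c * b) (hba : b ≤ ENNReal.ofReal c * a) :
    a * b⁻¹ + b * a⁻¹ ≤ ENNReal.ofReal (c + c⁻¹) := by
  have hx : 0 < a.toReal := ENNReal.toReal_pos ha ha'
  have hy : 0 < b.toReal := ENNReal.toReal_pos hb hb'
  rw [← ENNReal.ofReal_toReal ha', ← ENNReal.ofReal_toReal hb'] at hab hba ⊢
  generalize a.toReal = x at *
  generalize b.toReal = y at *
  rw [← ENNReal.ofReal_mul hc.le, ENNReal.ofReal_le_ofReal_iff (by positivity)] at hab hba
  rw [← ENNReal.ofReal_inv_of_pos hy, ← ENNReal.ofReal_inv_of_pos hx,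
    ← ENNReal.ofReal_mul hx.le, ← ENNReal.ofReal_mul hy.le,
    ← ENNReal.ofReal_add (by positivity) (by positivity)]
  apply ENNReal.ofReal_le_ofReal
  have h : 0 ≤ (c * y - x) * (c * x - y) := mul_nonneg (by linarith) (by linarith)
  rw [← sub_nonneg]
  have : c + c⁻¹ - (x * y⁻¹ + y * x⁻¹) = (c * y - x) * (c * x - y) / (c * x * y) := by
    field_simp
    ring
  rw [this]
  positivity

/-- If a positive function `F` on a probability space oscillates at most by the factor `exp l`, then
`𝔼 F * 𝔼 F⁻¹ ≤ cosh l`: symmetrize `𝔼 F * 𝔼 F⁻¹` into the mean of `F x / F y + F y / F x` over two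
independent points. -/
theorem lintegral_mul_lintegral_inv_le_cosh {Ω : Type*} [MeasurableSpace Ω] (P : Measure Ω)
    [IsProbabilityMeasure P] {F : Ω → ENNReal} (hF : Measurable F) (l : ℝ)
    (h0 : ∀ x, F x ≠ 0) (ht : ∀ x, F x ≠ ⊤)
    (hlip : ∀ x y, F x ≤ ENNReal.ofReal (Real.exp l) * F y) :
    (∫⁻ x, F x ∂P) * (∫⁻ x, (F x)⁻¹ ∂P) ≤ ENNReal.ofReal (Real.cosh l) := by
  have h1 : ∫⁻ x, ∫⁻ y, (F x * (F y)⁻¹ + F y * (F x)⁻¹) ∂P ∂P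
      = (∫⁻ x, F x ∂P) * (∫⁻ x, (F x)⁻¹ ∂P) + (∫⁻ x, F x ∂P) * (∫⁻ x, (F x)⁻¹ ∂P) := by
    have : ∀ x, ∫⁻ y, (F x * (F y)⁻¹ + F y * (F x)⁻¹) ∂P
        = F x * (∫⁻ y, (F y)⁻¹ ∂P) + (∫⁻ y, F y ∂P) * (F x)⁻¹ := fun x => by
      rw [lintegral_add_left (by fun_prop), lintegral_const_mul _ (by fun_prop),
        lintegral_mul_const _ hF]
    simp_rw [this]
    rw [lintegral_add_left (by fun_prop), lintegral_const_mul _ (by fun_prop),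
        lintegral_mul_const _ hF]
  have h2 : ∫⁻ x, ∫⁻ y, (F x * (F y)⁻¹ + F y * (F x)⁻¹) ∂P ∂P
      ≤ ENNReal.ofReal (Real.cosh l) + ENNReal.ofReal (Real.cosh l) := by
    rw [← ENNReal.ofReal_add (Real.cosh_pos l).le (Real.cosh_pos l).le]
    calc _ ≤ ∫⁻ x, ∫⁻ y, ENNReal.ofReal (Real.cosh l + Real.cosh l) ∂P ∂P := by
            refine lintegral_mono fun x => lintegral_mono fun y => ?_
            refine (ENNReal.mul_inv_add_mul_inv_le (Real.exp_pos l) (h0 x) (ht x) (h0 y) (ht y)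
              (hlip x y) (hlip y x)).trans_eq ?_
            rw [Real.cosh_eq, ← Real.exp_neg]
            congr 1
            ring
      _ = _ := by simp
  rw [h1, ← two_mul, ← two_mul] at h2
  exact (ENNReal.mul_le_mul_iff_right (by simp) (by simp)).1 h2

section Product

variable {δ : Type*} {X : δ → Type*} [∀ i, MeasurableSpace (X i)] (μ : ∀ i, Measure (X i))
  [∀ i, IsProbabilityMeasure (μ i)] [Fintype δ] [DecidableEq δ]

/-- The tensorized form of `lintegral_mul_lintegral_inv_le_cosh`. The coordinates are grouped into
blocks by the colouring `c`, and changing the coordinates of one block changes `F` at most by the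
factor `exp l`; each block that is integrated out costs a factor `cosh l`. -/
theorem lmarginal_mul_lmarginal_inv_le_cosh_pow (c : δ → ℕ) (l : ℝ) (s : Finset ℕ)
    (F : (∀ i, X i) → ENNReal) (hF : Measurable F) (h0 : ∀ x, F x ≠ 0) (ht : ∀ x, F x ≠ ⊤)
    (hlip : ∀ a x y, (∀ i, c i ≠ a → x i = y i) → F x ≤ ENNReal.ofReal (Real.exp l) * F y)
    (x : ∀ i, X i) :
    (∫⋯∫⁻_(Finset.univ.filter fun i => c i ∈ s), F ∂μ) x *
      (∫⋯∫⁻_(Finset.univ.filter fun i => c i ∈ s), (fun y => (F y)⁻¹) ∂μ) x ≤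
        ENNReal.ofReal (Real.cosh l) ^ s.card := by
  induction s using Finset.induction_on generalizing F with
  | empty =>
    simp [ENNReal.mul_inv_cancel (h0 x) (ht x)]
  | insert a s ha ih =>
    set A : Finset δ := Finset.univ.filter fun i => c i = a with hA
    set B : Finset δ := Finset.univ.filter fun i => c i ∈ s with hB
    have hAB : (Finset.univ.filter fun i => c i ∈ insert a s) = B ∪ A := by
      ext i
      simp [hA, hB, or_comm]
    have hdisj : Disjoint B A := by
      rw [Finset.disjoint_left]
      intro i hi hi'
      simp only [hA, hB, Finset.mem_filter_univ] at hi hi'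
      exact ha (hi' ▸ hi)
    have hFinv : Measurable fun y => (F y)⁻¹ := by fun_prop
    have hc0 : ENNReal.ofReal (Real.exp l) ≠ 0 := by simp [Real.exp_pos]
    have hup : ∀ y z : (∀ i, X i), (∀ i, c i ≠ a → y i = z i) →
        ∀ u v : (∀ i : A, X i), F (Function.updateFinset y A u) ≤
          ENNReal.ofReal (Real.exp l) * F (Function.updateFinset z A v) := by
      intro y z hyz u v
      refine hlip a _ _ fun i hi => ?_
      have : i ∉ A := by simpa [hA] using hi
      simp [Function.updateFinset, this, hyz i hi]
    set H := ∫⋯∫⁻_A, F ∂μ with hH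
    have hHm : Measurable H := Measurable.lmarginal μ hF
    -- averaging over one block keeps the values between `exp (-l) * F` and `exp l * F`
    have hHle : ∀ y, H y ≤ ENNReal.ofReal (Real.exp l) * F y := by
      intro y
      calc H y ≤ ∫⁻ _, ENNReal.ofReal (Real.exp l) * F y ∂Measure.pi fun i : A => μ i := by
            refine lintegral_mono fun u => ?_
            refine hlip a _ _ fun i hi => ?_
            have : i ∉ A := by simpa [hA] using hi
            simp [Function.updateFinset, this]
        _ = _ := by simp
    have hHge : ∀ y, F y ≤ ENNReal.ofReal (Real.exp l) * H y := by
      intro y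
      calc F y = ∫⁻ _, F y ∂Measure.pi fun i : A => μ i := by simp
        _ ≤ ∫⁻ u, ENNReal.ofReal (Real.exp l) * F (Function.updateFinset y A u)
            ∂Measure.pi fun i : A => μ i := by
            refine lintegral_mono fun u => ?_
            refine hlip a _ _ fun i hi => ?_
            have : i ∉ A := by simpa [hA] using hi
            simp [Function.updateFinset, this]
        _ = _ := by
            rw [lintegral_const_mul' _ _ (by simp)]
            rfl
    have hH0 : ∀ y, H y ≠ 0 := by
      intro y hy
      have := hHge y
      rw [hy, mul_zero] at this
      exact h0 y (le_antisymm this bot_le)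
    have hHt : ∀ y, H y ≠ ⊤ := fun y =>
      ne_top_of_le_ne_top (ENNReal.mul_ne_top (by simp) (ht y)) (hHle y)
    have hHlip : ∀ b y z, (∀ i, c i ≠ b → y i = z i) →
        H y ≤ ENNReal.ofReal (Real.exp l) * H z := by
      intro b y z hyz
      have : ENNReal.ofReal (Real.exp l) * H z
          = ∫⁻ u, ENNReal.ofReal (Real.exp l) * F (Function.updateFinset z A u)
            ∂Measure.pi fun i : A => μ i := by
        rw [lintegral_const_mul' _ _ (by simp)]
        rfl
      rw [this]
      refine lintegral_mono fun u => hlip b _ _ fun i hi => ?_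
      by_cases hiA : i ∈ A
      · simp [Function.updateFinset, hiA]
      · simp [Function.updateFinset, hiA, hyz i hi]
    have hblock : ∀ y, (∫⋯∫⁻_A, (fun y => (F y)⁻¹) ∂μ) y ≤
        ENNReal.ofReal (Real.cosh l) * (H y)⁻¹ := by
      intro y
      have hm : Measurable fun u : (∀ i : A, X i) => F (Function.updateFinset y A u) :=
        hF.comp measurable_updateFinset
      have h := lintegral_mul_lintegral_inv_le_cosh (Measure.pi fun i : A => μ i) hm l
        (fun u => h0 _) (fun u => ht _) (hup y y fun _ _ => rfl)
      have h' : H y * (∫⋯∫⁻_A, (fun y => (F y)⁻¹) ∂μ) y ≤ ENNReal.ofReal (Real.cosh l) := h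
      rw [← div_eq_mul_inv, ENNReal.le_div_iff_mul_le (Or.inl (hH0 y)) (Or.inl (hHt y)), mul_comm]
      exact h'
    rw [hAB, lmarginal_union μ F hF hdisj, lmarginal_union μ _ hFinv hdisj,
      Finset.card_insert_of_notMem ha, pow_succ]
    calc _ ≤ (∫⋯∫⁻_B, H ∂μ) x * (ENNReal.ofReal (Real.cosh l) *
          (∫⋯∫⁻_B, (fun y => (H y)⁻¹) ∂μ) x) := by
          gcongr
          calc _ ≤ (∫⋯∫⁻_B, (fun y => ENNReal.ofReal (Real.cosh l) * (H y)⁻¹) ∂μ) x :=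
                lmarginal_mono hblock x
            _ = _ := by
                simp only [lmarginal]
                rw [lintegral_const_mul' _ _ (by simp)]
      _ = ((∫⋯∫⁻_B, H ∂μ) x * (∫⋯∫⁻_B, (fun y => (H y)⁻¹) ∂μ) x) *
            ENNReal.ofReal (Real.cosh l) := by ring
      _ ≤ _ := by
          gcongr
          exact ih H hHm hH0 hHt hHlip

/-- A product form of the bounded differences inequality. If changing one of `K` blocks of
coordinates changes `f` by at most `1`, then `f` is not likely to be `≥ a` and not likely to be
`≤ b` at the same time, unless `a - b` is of order at most `√K`. -/
theorem measure_pi_ge_mul_measure_pi_le_le (c : δ → ℕ) {K : ℕ} (hc : ∀ i, c i < K)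
    (f : (∀ i, X i) → ℝ) (hf : Measurable f)
    (hlip : ∀ a x y, (∀ i, c i ≠ a → x i = y i) → f x ≤ f y + 1) {a b : ℝ} (hab : b ≤ a) :
    (Measure.pi μ).real {x | a ≤ f x} * (Measure.pi μ).real {x | f x ≤ b} ≤
      Real.exp (-(a - b) ^ 2 / (2 * K)) := by
  classical
  rcases isEmpty_or_nonempty (∀ i, X i) with hX | ⟨⟨x₀⟩⟩
  · simp [Set.eq_empty_of_isEmpty, (Real.exp_pos _).le]
  -- the optimal exponent
  set l : ℝ := (a - b) / K with hl
  have hl0 : 0 ≤ l := div_nonneg (by linarith) (by positivity)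
  set F : (∀ i, X i) → ENNReal := fun x => ENNReal.ofReal (Real.exp (l * f x)) with hFdef
  have hF : Measurable F := by fun_prop
  have huniv : (Finset.univ.filter fun i => c i ∈ Finset.range K) = Finset.univ := by
    simp [hc]
  have hF0 : ∀ x, F x ≠ 0 := fun x => by simp [hFdef, Real.exp_pos]
  have hFt : ∀ x, F x ≠ ⊤ := fun x => by simp [hFdef]
  have key := lmarginal_mul_lmarginal_inv_le_cosh_pow μ c l (Finset.range K) F hF hF0 hFt (by
      intro a x y hxy
      simp only [hFdef]
      rw [← ENNReal.ofReal_mul (Real.exp_pos _).le, ← Real.exp_add]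
      apply ENNReal.ofReal_le_ofReal
      rw [Real.exp_le_exp]
      nlinarith [hlip a x y hxy]) x₀
  rw [huniv, lmarginal_univ, lmarginal_univ, Finset.card_range] at key
  have m1 : ENNReal.ofReal (Real.exp (l * a)) * Measure.pi μ {x | a ≤ f x} ≤
      ∫⁻ x, F x ∂Measure.pi μ := by
    refine le_trans ?_ (mul_meas_ge_le_lintegral hF (ENNReal.ofReal (Real.exp (l * a))))
    gcongr with x
    intro hx
    apply ENNReal.ofReal_le_ofReal
    rw [Real.exp_le_exp]
    exact mul_le_mul_of_nonneg_left hx hl0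
  have m2 : ENNReal.ofReal (Real.exp (-(l * b))) * Measure.pi μ {x | f x ≤ b} ≤
      ∫⁻ x, (F x)⁻¹ ∂Measure.pi μ := by
    refine le_trans ?_ (mul_meas_ge_le_lintegral (by fun_prop) (ENNReal.ofReal (Real.exp (-(l * b)))))
    gcongr with x
    intro hx
    simp only [hFdef]
    rw [← ENNReal.ofReal_inv_of_pos (Real.exp_pos _), ← Real.exp_neg]
    apply ENNReal.ofReal_le_ofReal
    rw [Real.exp_le_exp]
    exact neg_le_neg (mul_le_mul_of_nonneg_left hx hl0)
  have m3 := (mul_le_mul' m1 m2).trans key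
  have m4 := ENNReal.toReal_mono (by simp) m3
  simp only [ENNReal.toReal_mul, ENNReal.toReal_pow, ENNReal.toReal_ofReal (Real.exp_pos _).le,
    ENNReal.toReal_ofReal (Real.cosh_pos _).le] at m4
  change Real.exp (l * a) * (Measure.pi μ).real {x | a ≤ f x} *
    (Real.exp (-(l * b)) * (Measure.pi μ).real {x | f x ≤ b}) ≤ _ at m4
  set u := (Measure.pi μ).real {x | a ≤ f x} * (Measure.pi μ).real {x | f x ≤ b}
  have m5 : Real.exp (l * (a - b)) * u ≤ Real.exp (l ^ 2 / 2 * K) := by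
    calc _ = Real.exp (l * a) * (Measure.pi μ).real {x | a ≤ f x} *
          (Real.exp (-(l * b)) * (Measure.pi μ).real {x | f x ≤ b}) := by
          rw [show l * (a - b) = l * a + -(l * b) by ring, Real.exp_add]
          ring
      _ ≤ Real.cosh l ^ K := m4
      _ ≤ Real.exp (l ^ 2 / 2) ^ K := by
          gcongr
          exact Real.cosh_le_exp_half_sq l
      _ = _ := by rw [← Real.exp_nat_mul]; ring_nf
  have m6 : u ≤ Real.exp (-(l * (a - b))) * Real.exp (l ^ 2 / 2 * K) := by
    calc u = Real.exp (-(l * (a - b))) * (Real.exp (l * (a - b)) * u) := by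
          rw [← mul_assoc, ← Real.exp_add]; simp
      _ ≤ _ := by gcongr
  refine m6.trans_eq ?_
  rw [← Real.exp_add]
  congr 1
  rcases Nat.eq_zero_or_pos K with h | h
  · simp [hl, h]
  · rw [hl]
    field_simp
    ring

end Product

/-! ### The binomial random graph as a product measure -/

namespace SimpleGraph

variable {V : Type*}

instance [Finite V] : DiscreteMeasurableSpace (SimpleGraph V) where
  forall_measurableSet s := by
    have : s = edgeSet ⁻¹' (edgeSet '' s) := (Set.preimage_image_eq s edgeSet_injective).symm
    rw [this]
    have h : MeasurableSet (edgeSet '' s) := MeasurableSet.of_discrete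
    exact measurable_edgeSet h

/-- The law of the indicator of a potential edge `e` in the binomial random graph; it is the Dirac
mass at `False` on the diagonal. -/
noncomputable def edgeLaw (p : unitInterval) (e : Sym2 V) : Measure Prop :=
  unitInterval.toNNReal p • Measure.dirac (e ∈ Sym2.diagSetᶜ) +
    unitInterval.toNNReal (unitInterval.symm p) • Measure.dirac False

instance (p : unitInterval) (e : Sym2 V) : IsProbabilityMeasure (edgeLaw p e) := by
  unfold edgeLaw
  infer_instance

theorem binomialRandom_real_eq_pi [Fintype V] (p : unitInterval) (S : Set (SimpleGraph V)) :
    (G(V, p)).real S =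
      (Measure.pi fun e : Sym2 V => edgeLaw p e).real {x | fromEdgeSet {e | x e} ∈ S} := by
  classical
  have h : G(V, p) = Measure.map (fun x : Sym2 V → Prop => fromEdgeSet {e | x e})
      (Measure.pi fun e : Sym2 V => edgeLaw p e) := by
    rw [binomialRandom_eq_map, setBernoulli_eq_map, Measure.map_map measurable_fromEdgeSet
      Measurable.of_discrete, ← Measure.infinitePi_eq_pi]
    rfl
  rw [h, measureReal_def, Measure.map_apply Measurable.of_discrete MeasurableSet.of_discrete]
  rfl

/-- The probability that all pairs in `A` are edges and no pair in `B` is one. -/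
theorem binomialRandom_real_cylinder [Fintype V] [DecidableEq V] (p : unitInterval)
    (A B : Finset (Sym2 V))
    (hAB : Disjoint A B) (hA : ∀ e ∈ A, ¬ e.IsDiag) (hB : ∀ e ∈ B, ¬ e.IsDiag) :
    (G(V, p)).real {G | (∀ e ∈ A, e ∈ G.edgeSet) ∧ ∀ e ∈ B, e ∉ G.edgeSet} =
      (p : ℝ) ^ A.card * (1 - p : ℝ) ^ B.card := by
  classical
  rw [binomialRandom_real_eq_pi]
  have hset : {x : Sym2 V → Prop | fromEdgeSet {e | x e} ∈
      {G : SimpleGraph V | (∀ e ∈ A, e ∈ G.edgeSet) ∧ ∀ e ∈ B, e ∉ G.edgeSet}} =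
      Set.univ.pi fun e => if e ∈ A then {True} else if e ∈ B then {False} else Set.univ := by
    ext x
    simp only [Set.mem_ofPred_eq, edgeSet_fromEdgeSet, Set.mem_sdiff, Set.mem_univ_pi]
    constructor
    · rintro ⟨h1, h2⟩ e
      by_cases heA : e ∈ A
      · simpa [heA] using (h1 e heA).1
      · by_cases heB : e ∈ B
        · have := h2 e heB
          have hd := hB e heB
          simpa [heA, heB, hd] using this
        · simp [heA, heB]
    · intro h
      refine ⟨fun e he => ⟨?_, hA e he⟩, fun e he h' => ?_⟩
      · simpa [he] using h e
      · have := h e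
        rw [if_neg (Finset.disjoint_right.1 hAB he), if_pos he] at this
        simp only [Set.mem_singleton_iff] at this
        exact this ▸ h'.1
  rw [hset, measureReal_def, Measure.pi_pi, ENNReal.toReal_prod]
  have hval : ∀ e : Sym2 V, ((edgeLaw p e) (if e ∈ A then {True} else if e ∈ B then {False}
      else Set.univ)).toReal = (if e ∈ A then (p : ℝ) else 1) * (if e ∈ B then 1 - p else 1 : ℝ) := by
    intro e
    by_cases heA : e ∈ A
    · have hd := hA e heA
      have heB := Finset.disjoint_left.1 hAB heA
      simp [edgeLaw, heA, heB, hd]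
    · by_cases heB : e ∈ B
      · have hd := hB e heB
        simp [edgeLaw, heA, heB, hd]
      · simp [heA, heB]
  simp_rw [hval]
  rw [Finset.prod_mul_distrib]
  simp [Finset.prod_ite_mem]

/-- The bounded differences inequality for the binomial random graph, for a partition of the
potential edges into `K` classes. -/
theorem binomialRandom_real_ge_mul_le_le [Fintype V] (p : unitInterval) (c : Sym2 V → ℕ) {K : ℕ}
    (hc : ∀ e, c e < K) (f : SimpleGraph V → ℝ)
    (hlip : ∀ a (G H : SimpleGraph V), (∀ e, c e ≠ a → (e ∈ G.edgeSet ↔ e ∈ H.edgeSet)) →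
      f G ≤ f H + 1) {a b : ℝ} (hab : b ≤ a) :
    (G(V, p)).real {G | a ≤ f G} * (G(V, p)).real {G | f G ≤ b} ≤
      Real.exp (-(a - b) ^ 2 / (2 * K)) := by
  classical
  rw [binomialRandom_real_eq_pi, binomialRandom_real_eq_pi]
  refine measure_pi_ge_mul_measure_pi_le_le (fun e : Sym2 V => edgeLaw p e) c hc
    (fun x => f (fromEdgeSet {e | x e})) Measurable.of_discrete ?_ hab
  intro a x y hxy
  refine hlip a _ _ fun e he => ?_
  simp [hxy e he]

end SimpleGraph

/-! ### The second moment method -/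

/-- If the pair probabilities of a finite family of events add up to at most `B` times the square of
the expected number of events, then one of the events occurs with probability at least `1 / B`. -/
theorem one_div_le_measureReal_iUnion {Ω ι : Type*} [MeasurableSpace Ω] [DiscreteMeasurableSpace Ω]
    [Fintype ι] (P : Measure Ω) [IsProbabilityMeasure P] (A : ι → Set Ω) {B : ℝ} (hB : 0 < B)
    (hpos : 0 < ∑ i, P.real (A i))
    (h : ∑ i, ∑ j, P.real (A i ∩ A j) ≤ B * (∑ i, P.real (A i)) ^ 2) :
    1 / B ≤ P.real (⋃ i, A i) := by
  classical
  set M := ∑ i, P.real (A i) with hM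
  set l : ℝ := 1 / (B * M) with hl
  set Y : Ω → ℝ := fun x => ∑ i, (A i).indicator 1 x with hY
  have hYi : ∀ i, Integrable ((A i).indicator (1 : Ω → ℝ)) P := fun i =>
    (integrable_const (1 : ℝ)).indicator MeasurableSet.of_discrete
  have hY1 : ∫ x, Y x ∂P = M := by
    rw [hY, integral_finsetSum _ fun i _ => hYi i]
    simp [integral_indicator_one MeasurableSet.of_discrete, hM]
  have hYY : ∀ x, Y x ^ 2 = ∑ i, ∑ j, (A i ∩ A j).indicator (1 : Ω → ℝ) x := by
    intro x
    rw [hY, sq, Finset.sum_mul_sum]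
    simp [Set.inter_indicator_one]
  have hYi2 : ∀ i j, Integrable ((A i ∩ A j).indicator (1 : Ω → ℝ)) P := fun i j =>
    (integrable_const (1 : ℝ)).indicator MeasurableSet.of_discrete
  have hY2 : ∫ x, Y x ^ 2 ∂P = ∑ i, ∑ j, P.real (A i ∩ A j) := by
    simp_rw [hYY]
    rw [integral_finsetSum _ fun i _ => integrable_finsetSum _ fun j _ => hYi2 i j]
    refine Finset.sum_congr rfl fun i _ => ?_
    rw [integral_finsetSum _ fun j _ => hYi2 i j]
    simp [integral_indicator_one MeasurableSet.of_discrete]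
  have hI1 : Integrable Y P := integrable_finsetSum _ fun i _ => hYi i
  have hI2 : Integrable (fun x => Y x ^ 2) P := by
    simp_rw [hYY]
    exact integrable_finsetSum _ fun i _ => integrable_finsetSum _ fun j _ => hYi2 i j
  have hpt : ∀ x, 2 * l * Y x - l ^ 2 * Y x ^ 2 ≤ (⋃ i, A i).indicator (1 : Ω → ℝ) x := by
    intro x
    by_cases hx : x ∈ ⋃ i, A i
    · rw [Set.indicator_of_mem hx]
      simp only [Pi.one_apply]
      nlinarith [sq_nonneg (l * Y x - 1)]
    · rw [Set.indicator_of_notMem hx]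
      have : Y x = 0 := by
        rw [hY]
        refine Finset.sum_eq_zero fun i _ => Set.indicator_of_notMem (fun hi => hx ?_) _
        exact Set.mem_iUnion.2 ⟨i, hi⟩
      simp [this]
  have hint := integral_mono ((hI1.const_mul (2 * l)).sub (hI2.const_mul (l ^ 2)))
    ((integrable_const (1 : ℝ)).indicator (MeasurableSet.of_discrete (s := ⋃ i, A i))) hpt
  have e1 : ∫ x, (2 * l * Y x - l ^ 2 * Y x ^ 2) ∂P =
      2 * l * M - l ^ 2 * ∑ i, ∑ j, P.real (A i ∩ A j) := by
    rw [integral_sub (hI1.const_mul (2 * l)) (hI2.const_mul (l ^ 2)), integral_const_mul,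
      integral_const_mul, hY1, hY2]
  have e2 : ∫ x, (⋃ i, A i).indicator (1 : Ω → ℝ) x ∂P = P.real (⋃ i, A i) :=
    integral_indicator_one MeasurableSet.of_discrete
  have hint' : 2 * l * M - l ^ 2 * ∑ i, ∑ j, P.real (A i ∩ A j) ≤ P.real (⋃ i, A i) := by
    rw [← e1, ← e2]
    exact hint
  refine le_trans ?_ hint'
  have : l ^ 2 * ∑ i, ∑ j, P.real (A i ∩ A j) ≤ l ^ 2 * (B * M ^ 2) := by gcongr
  have h3 : 2 * l * M - l ^ 2 * (B * M ^ 2) = 1 / B := by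
    rw [hl]
    field_simp
    ring
  linarith

/-! ### One-degenerate graphs and `T`-matchings -/

namespace SimpleGraph

variable {V W : Type*}

/-- Every nonempty set of vertices contains a vertex with at most one neighbour in that set. For
finite graphs this is the same as being a forest; in this form it passes to induced subgraphs and
from the components to the whole graph without any discussion of cycles. -/
def IsOneDegenerate (G : SimpleGraph V) : Prop :=
  ∀ J : Set V, J.Nonempty → ∃ v ∈ J, ∀ u ∈ J, ∀ u' ∈ J, G.Adj v u → G.Adj v u' → u = u'

theorem IsTree.isOneDegenerate [Finite W] {T : SimpleGraph W} (hT : T.IsTree) :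
    T.IsOneDegenerate := by
  classical
  intro J hJ
  obtain ⟨v₀, hv₀⟩ := hJ
  have hac : (T.induce J).IsAcyclic := hT.isAcyclic.induce J
  set C := (T.induce J).connectedComponentMk ⟨v₀, hv₀⟩ with hC
  have hCT : C.toSimpleGraph.IsTree := hac.isTree_connectedComponent C
  have : Fintype C := Fintype.ofFinite _
  have hleaf : ∃ v : C, ∀ u u' : C, C.toSimpleGraph.Adj v u → C.toSimpleGraph.Adj v u' → u = u' := by
    rcases subsingleton_or_nontrivial C with h | h
    · exact ⟨⟨⟨v₀, hv₀⟩, rfl⟩, fun u u' _ _ => Subsingleton.elim _ _⟩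
    · obtain ⟨v, hv⟩ := hCT.exists_vert_degree_one_of_nontrivial
      obtain ⟨w, _, hw⟩ := (degree_eq_one_iff_existsUnique_adj).1 hv
      exact ⟨v, fun u u' h h' => (hw u h).trans (hw u' h').symm⟩
  obtain ⟨v, hv⟩ := hleaf
  refine ⟨v.1.1, v.1.2, fun u hu u' hu' h h' => ?_⟩
  have mem : ∀ u (hu : u ∈ J), T.Adj v.1.1 u → (⟨u, hu⟩ : J) ∈ C.supp := by
    intro u hu h
    have hadj : (T.induce J).Adj v.1 ⟨u, hu⟩ := h
    exact (C.mem_supp_congr_adj hadj).1 v.2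
  have := hv ⟨⟨u, hu⟩, mem u hu h⟩ ⟨⟨u', hu'⟩, mem u' hu' h'⟩ h h'
  simpa using this

theorem IsOneDegenerate.induce {G : SimpleGraph V} (h : G.IsOneDegenerate) (S : Set V) :
    (G.induce S).IsOneDegenerate := by
  intro J hJ
  obtain ⟨v, ⟨v', hv', rfl⟩, hv⟩ := h (Subtype.val '' J) (hJ.image _)
  exact ⟨v', hv', fun u hu u' hu' h h' =>
    Subtype.ext (hv u ⟨u, hu, rfl⟩ u' ⟨u', hu', rfl⟩ h h')⟩

theorem IsTMatching.isOneDegenerate {T : SimpleGraph W} {H : SimpleGraph V}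
    (hH : IsTMatching T H) (hT : T.IsOneDegenerate) : H.IsOneDegenerate := by
  intro J ⟨v₀, hv₀⟩
  set C := H.connectedComponentMk v₀ with hC
  obtain ⟨f⟩ := hH C
  obtain ⟨w, ⟨v, hvJ, rfl⟩, hw⟩ := hT (f '' {c | c.1 ∈ J}) ⟨_, ⟨⟨v₀, rfl⟩, hv₀, rfl⟩⟩
  refine ⟨v.1, hvJ, fun u hu u' hu' h h' => ?_⟩
  have mem : ∀ u, H.Adj v.1 u → u ∈ C.supp := fun u h => (C.mem_supp_congr_adj h).1 v.2
  have := hw (f ⟨u, mem u h⟩) ⟨_, hu, rfl⟩ (f ⟨u', mem u' h'⟩) ⟨_, hu', rfl⟩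
    (f.map_adj_iff.2 h) (f.map_adj_iff.2 h')
  simpa using this

/-- The disjoint union of copies of `T` indexed by `α`. -/
abbrev copies (α : Type*) (T : SimpleGraph W) : SimpleGraph (α × W) := (⊥ : SimpleGraph α) □ T

theorem copies_adj {α : Type*} {T : SimpleGraph W} {x y : α × W} :
    (copies α T).Adj x y ↔ x.1 = y.1 ∧ T.Adj x.2 y.2 := by
  simp [copies, boxProd_adj, and_comm]

theorem isTMatching_copies {α : Type*} {T : SimpleGraph W} (hT : T.Connected) :
    IsTMatching T (copies α T) := by
  intro C
  obtain ⟨⟨a, w₀⟩, rfl⟩ := C.exists_rep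
  have hfst : ∀ x y : α × W, (copies α T).Reachable x y → x.1 = y.1 := by
    rintro x y ⟨p⟩
    induction p with
    | nil => rfl
    | cons h _ ih => exact (copies_adj.1 h).1.trans ih
  let g : T →g copies α T := ⟨fun w => (a, w), fun h => copies_adj.2 ⟨rfl, h⟩⟩
  have hmem : ∀ w, (a, w) ∈ ((copies α T).connectedComponentMk (a, w₀)).supp := fun w =>
    ConnectedComponent.sound ((hT.preconnected w w₀).map g)
  refine ⟨RelIso.symm ⟨⟨fun w => ⟨(a, w), hmem w⟩, fun c => c.1.2, fun w => rfl, ?_⟩, ?_⟩⟩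
  · rintro ⟨⟨b, w⟩, hb⟩
    have : b = a := hfst _ _ (ConnectedComponent.exact hb)
    simp [this]
  · intro u v
    change (copies α T).Adj (a, u) (a, v) ↔ T.Adj u v
    simp

theorem IsTMatching.congr_iso {V' : Type*} {T : SimpleGraph W} {H : SimpleGraph V}
    {H' : SimpleGraph V'} (f : H ≃g H') (h : IsTMatching T H') : IsTMatching T H := by
  intro C
  obtain ⟨v, rfl⟩ := C.exists_rep
  obtain ⟨g⟩ := h (f.connectedComponentEquiv (H.connectedComponentMk v))
  refine ⟨RelIso.trans ?_ g⟩
  refine ⟨⟨fun c => ⟨f c.1, ?_⟩, fun c => ⟨f.symm c.1, ?_⟩, fun c => ?_, fun c => ?_⟩, ?_⟩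
  · have := ConnectedComponent.exact c.2
    exact ConnectedComponent.sound (this.map f.toHom)
  · have := (ConnectedComponent.exact c.2).map f.symm.toHom
    refine ConnectedComponent.sound ?_
    simpa using this
  · simp
  · simp
  · intro a b
    exact f.map_adj_iff

/-- A vertex set that induces disjoint copies of `T` bounds the largest `T`-matching from below. -/
theorem card_mul_card_le_maxInducedTMatchingOrder [Finite V] [Fintype W] {T : SimpleGraph W}
    (hT : T.Connected) {α : Type*} [Fintype α] (G : SimpleGraph V) (θ : α × W → V)
    (hθ : Function.Injective θ)
    (hadj : ∀ x y, G.Adj (θ x) (θ y) ↔ (copies α T).Adj x y) :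
    Fintype.card α * Fintype.card W ≤ maxInducedTMatchingOrder T G := by
  have f : G.induce (Set.range θ) ≃g copies α T :=
    (RelIso.symm ⟨Equiv.ofInjective θ hθ, by
      intro a b
      exact hadj a b⟩)
  refine (isGreatest_maxInducedTMatchingOrder T G).2 ⟨Set.range θ,
    (isTMatching_copies hT).congr_iso f, ?_⟩
  rw [Set.ncard_range_of_injective hθ, Nat.card_prod, Nat.card_eq_fintype_card,
    Nat.card_eq_fintype_card]

/-- A one-degenerate graph on `J` has at most `#J` edges. -/
theorem card_filter_edgeSet_sym2_le [DecidableEq V] (G : SimpleGraph V) (J : Finset V)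
    [DecidablePred (· ∈ G.edgeSet)]
    (h : ∀ J' ⊆ J, J'.Nonempty → ∃ v ∈ J', ∀ u ∈ J', ∀ u' ∈ J', G.Adj v u → G.Adj v u' → u = u') :
    (J.sym2.filter (· ∈ G.edgeSet)).card ≤ J.card := by
  induction J using Finset.strongInduction with
  | H J ih =>
    rcases J.eq_empty_or_nonempty with rfl | hJ
    · simp
    obtain ⟨v, hv, huniq⟩ := h J subset_rfl hJ
    have ih' := ih (J.erase v) (Finset.erase_ssubset hv)
      fun J' hJ' hne => h J' (hJ'.trans (Finset.erase_subset _ _)) hne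
    rw [← Finset.insert_erase hv, Finset.sym2_insert, Finset.filter_union,
      Finset.card_insert_of_notMem (Finset.notMem_erase _ _)]
    refine (Finset.card_union_le _ _).trans ?_
    rw [add_comm]
    refine add_le_add ih' ?_
    rw [Finset.card_le_one]
    intro e he e' he'
    simp only [Finset.mem_filter, Finset.mem_image, Finset.insert_erase hv] at he he'
    obtain ⟨⟨u, hu, rfl⟩, hadj⟩ := he
    obtain ⟨⟨u', hu', rfl⟩, hadj'⟩ := he'
    rw [huniq u hu u' hu' hadj hadj']

/-- The weighted number of maps `σ` from a forest with vertex set `ι` to a graph `D` of maximum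
degree at most `Δ`, each edge of the forest among the vertices of `J` that `σ` maps to an edge of
`D` counting with weight `x ≥ 1`. Leaves are removed one after the other: once the image of its
neighbour is fixed, the image of a leaf contributes at most `|κ| + Δ x`. -/
theorem card_pow_mul_sum_pow_le {ι κ : Type*} [Fintype ι] [DecidableEq ι] [Fintype κ]
    (F : SimpleGraph ι) (D : SimpleGraph κ) [DecidablePred (· ∈ F.edgeSet)] [DecidableRel D.Adj]
    [DecidablePred (· ∈ D.edgeSet)]
    (hF : F.IsOneDegenerate) (Δ : ℕ) (hD : ∀ c, (Finset.univ.filter (D.Adj c)).card ≤ Δ)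
    {x : ℝ} (hx : 1 ≤ x) (J : Finset ι) :
    (Fintype.card κ : ℝ) ^ J.card * ∑ σ : ι → κ,
        x ^ (J.sym2.filter fun e => e ∈ F.edgeSet ∧ e.map σ ∈ D.edgeSet).card ≤
      (Fintype.card κ + Δ * x) ^ J.card * (Fintype.card κ : ℝ) ^ Fintype.card ι := by
  classical
  have hx0 : 0 ≤ x := by linarith
  induction J using Finset.strongInduction with
  | H J ih =>
    rcases J.eq_empty_or_nonempty with rfl | hJ
    · simp
    obtain ⟨v, hv, huniq⟩ := hF J hJ
    have hv : v ∈ J := hv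
    set I := J.erase v with hI
    have ih' := ih I (Finset.erase_ssubset hv)
    have hvI : v ∉ I := Finset.notMem_erase _ _
    have hins : insert v I = J := Finset.insert_erase hv
    have hcard : J.card = I.card + 1 := by rw [← hins, Finset.card_insert_of_notMem hvI]
    set e : (ι → κ) → Finset (Sym2 ι) := fun σ =>
      I.sym2.filter fun e => e ∈ F.edgeSet ∧ e.map σ ∈ D.edgeSet with he
    set e' : (ι → κ) → Finset (Sym2 ι) := fun σ =>
      J.sym2.filter fun e => e ∈ F.edgeSet ∧ e.map σ ∈ D.edgeSet with he'
    have hupd : ∀ σ c, e (Function.update σ v c) = e σ := by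
      intro σ c
      refine Finset.filter_congr fun z hz => ?_
      induction z with
      | _ a b =>
        rw [Finset.mk_mem_sym2_iff] at hz
        have ha : a ≠ v := fun h => hvI (h ▸ hz.1)
        have hb : b ≠ v := fun h => hvI (h ▸ hz.2)
        simp [ha, hb]
    -- the sum over the image of `v`, the other images being fixed
    have hinner : ∀ σ : ι → κ, ∑ c, x ^ (e' (Function.update σ v c)).card ≤
        x ^ (e σ).card * (Fintype.card κ + Δ * x) := by
      intro σ
      by_cases hu : ∃ u ∈ J, F.Adj v u
      · obtain ⟨u, huJ, hvu⟩ := hu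
        have huv : u ≠ v := hvu.ne'
        have hle : ∀ c, x ^ (e' (Function.update σ v c)).card ≤
            x ^ (e σ).card * (1 + if D.Adj (σ u) c then x else 0) := by
          intro c
          have hsub : e' (Function.update σ v c) ⊆
              e σ ∪ if D.Adj (σ u) c then {s(v, u)} else ∅ := by
            intro z hz
            rw [he', Finset.mem_filter, ← hins, Finset.sym2_insert, Finset.mem_union] at hz
            obtain ⟨hz1 | hz1, hz2⟩ := hz
            · obtain ⟨b, hb, rfl⟩ := Finset.mem_image.1 hz1
              have hbJ : b ∈ J := hins ▸ hb
              have hbu : b = u := huniq b hbJ u huJ hz2.1 hvu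
              subst hbu
              have hD' := hz2.2
              simp only [Sym2.map_mk, Function.update_self,
                Function.update_of_ne huv, mem_edgeSet] at hD'
              simp [hD'.symm]
            · apply Finset.mem_union_left
              rw [← hupd σ c]
              exact Finset.mem_filter.2 ⟨hz1, hz2⟩
          split_ifs with hc
          · have h1 : (e' (Function.update σ v c)).card ≤ (e σ).card + 1 := by
              rw [if_pos hc] at hsub
              exact (Finset.card_le_card hsub).trans ((Finset.card_union_le _ _).trans (by simp))
            calc _ ≤ x ^ ((e σ).card + 1) := pow_le_pow_right₀ hx h1
              _ = x ^ (e σ).card * x := pow_succ _ _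
              _ ≤ _ := by gcongr; linarith
          · rw [if_neg hc, Finset.union_empty] at hsub
            rw [add_zero, mul_one]
            exact pow_le_pow_right₀ hx (Finset.card_le_card hsub)
        refine (Finset.sum_le_sum fun c _ => hle c).trans ?_
        rw [← Finset.mul_sum, Finset.sum_add_distrib, ← Finset.sum_filter, Finset.sum_const,
          Finset.sum_const]
        simp only [Finset.card_univ, nsmul_eq_mul, mul_one]
        gcongr
        exact hD _
      · have hle : ∀ c, x ^ (e' (Function.update σ v c)).card ≤ x ^ (e σ).card := by
          intro c
          apply pow_le_pow_right₀ hx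
          apply Finset.card_le_card
          intro z hz
          rw [he', Finset.mem_filter, ← hins, Finset.sym2_insert, Finset.mem_union] at hz
          obtain ⟨hz1 | hz1, hz2⟩ := hz
          · obtain ⟨b, hb, rfl⟩ := Finset.mem_image.1 hz1
            exact absurd ⟨b, hins ▸ hb, hz2.1⟩ hu
          · rw [← hupd σ c]
            exact Finset.mem_filter.2 ⟨hz1, hz2⟩
        refine (Finset.sum_le_sum fun c _ => hle c).trans ?_
        simp only [Finset.sum_const, Finset.card_univ, nsmul_eq_mul]
        rw [mul_comm]
        gcongr
        have : (0 : ℝ) ≤ Δ * x := by positivity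
        linarith
    -- resampling the image of `v` does not change the sum
    have havg : (Fintype.card κ : ℝ) * ∑ σ : ι → κ, x ^ (e' σ).card =
        ∑ σ : ι → κ, ∑ c, x ^ (e' (Function.update σ v c)).card := by
      let E := Equiv.funSplitAt v κ
      have hE : ∀ (y : κ × ({j // j ≠ v} → κ)) (c : κ),
          Function.update (E.symm y) v c = E.symm (c, y.2) := by
        intro y c
        ext j
        by_cases hj : j = v
        · subst hj; simp [E, Equiv.funSplitAt, Equiv.piSplitAt]
        · simp [E, Equiv.funSplitAt, Equiv.piSplitAt, hj]
      rw [← E.symm.sum_comp, ← E.symm.sum_comp]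
      simp_rw [hE]
      rw [Fintype.sum_prod_type, Fintype.sum_prod_type]
      simp only [Finset.sum_const, Finset.card_univ, nsmul_eq_mul]
      rw [Finset.sum_comm]
    calc (Fintype.card κ : ℝ) ^ J.card * ∑ σ : ι → κ, x ^ (e' σ).card
        = (Fintype.card κ : ℝ) ^ I.card *
            ∑ σ : ι → κ, ∑ c, x ^ (e' (Function.update σ v c)).card := by
          rw [hcard, pow_succ, mul_assoc, havg]
      _ ≤ (Fintype.card κ : ℝ) ^ I.card *
            ∑ σ : ι → κ, x ^ (e σ).card * (Fintype.card κ + Δ * x) := by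
          gcongr with σ
          exact hinner σ
      _ = (Fintype.card κ + Δ * x) *
            ((Fintype.card κ : ℝ) ^ I.card * ∑ σ : ι → κ, x ^ (e σ).card) := by
          rw [← Finset.sum_mul]
          ring
      _ ≤ (Fintype.card κ + Δ * x) * ((Fintype.card κ + Δ * x) ^ I.card *
            (Fintype.card κ : ℝ) ^ Fintype.card ι) := by
          gcongr
      _ = _ := by rw [hcard]; ring

end SimpleGraph

/-! ### The first moment bound -/

namespace SimpleGraph

variable {V W : Type*}

/-- A Chernoff-type bound for the lower tail of the number of edges inside a fixed vertex set. -/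
theorem binomialRandom_real_card_edges_le [Fintype V] [DecidableEq V] (p : unitInterval)
    (S : Finset V) (E : SimpleGraph V → Finset (Sym2 V))
    (hE : ∀ G e, e ∈ E G ↔ e ∈ S.sym2 ∧ e ∈ G.edgeSet) {s : ℝ} (hs : 0 < s) (hs1 : s ≤ 1) :
    (G(V, p)).real {G | (E G).card ≤ S.card} ≤
      (s ^ S.card)⁻¹ * ((p : ℝ) * s + (1 - p)) ^ (S.card.choose 2) := by
  classical
  have hp0 : (0 : ℝ) ≤ p := p.2.1
  have hp1 : (0 : ℝ) ≤ 1 - p := sub_nonneg.2 p.2.2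
  set Q : Finset (Sym2 V) := S.offDiag.image Sym2.mk.uncurry with hQ
  have hQc : Q.card = S.card.choose 2 := Sym2.card_image_offDiag S
  have hQmem : ∀ e, e ∈ Q ↔ e ∈ S.sym2 ∧ ¬ e.IsDiag := by
    intro e
    induction e with
    | _ a b =>
      simp only [hQ, Finset.mem_image, Finset.mem_offDiag, Prod.exists, Finset.mk_mem_sym2_iff,
        Sym2.mk_isDiag_iff]
      constructor
      · rintro ⟨x, y, ⟨hx, hy, hxy⟩, h⟩
        simp only [Function.uncurry_apply_pair, Sym2.eq_iff] at h
        rcases h with ⟨rfl, rfl⟩ | ⟨rfl, rfl⟩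
        · exact ⟨⟨hx, hy⟩, hxy⟩
        · exact ⟨⟨hy, hx⟩, Ne.symm hxy⟩
      · rintro ⟨⟨hx, hy⟩, hxy⟩
        exact ⟨a, b, ⟨hx, hy, hxy⟩, rfl⟩
  have hcover : {G : SimpleGraph V | (E G).card ≤ S.card} ⊆
      ⋃ D ∈ Q.powerset.filter (fun D => D.card ≤ S.card),
        {G : SimpleGraph V | (∀ e ∈ D, e ∈ G.edgeSet) ∧ ∀ e ∈ Q \ D, e ∉ G.edgeSet} := by
    intro G hG
    simp only [Set.mem_iUnion]
    refine ⟨E G, ?_, fun e he => ((hE G e).1 he).2, fun e he h => ?_⟩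
    · rw [Finset.mem_filter, Finset.mem_powerset]
      refine ⟨fun e he => ?_, hG⟩
      obtain ⟨h1, h2⟩ := (hE G e).1 he
      exact (hQmem e).2 ⟨h1, G.not_isDiag_of_mem_edgeSet h2⟩
    · rw [Finset.mem_sdiff] at he
      exact he.2 ((hE G e).2 ⟨((hQmem e).1 he.1).1, h⟩)
  calc _ ≤ _ := measureReal_mono hcover (measure_ne_top _ _)
    _ ≤ ∑ D ∈ Q.powerset.filter (fun D => D.card ≤ S.card), (G(V, p)).real
          {G : SimpleGraph V | (∀ e ∈ D, e ∈ G.edgeSet) ∧ ∀ e ∈ Q \ D, e ∉ G.edgeSet} :=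
        measureReal_biUnion_finset_le _ _
    _ ≤ ∑ D ∈ Q.powerset.filter (fun D => D.card ≤ S.card),
          (s ^ S.card)⁻¹ * (((p : ℝ) * s) ^ D.card * (1 - p : ℝ) ^ (Q.card - D.card)) := by
        refine Finset.sum_le_sum fun D hD => ?_
        rw [Finset.mem_filter, Finset.mem_powerset] at hD
        rw [binomialRandom_real_cylinder p D (Q \ D) Finset.disjoint_sdiff
          (fun e he => ((hQmem e).1 (hD.1 he)).2)
          (fun e he => ((hQmem e).1 (Finset.mem_sdiff.1 he).1).2),
          Finset.card_sdiff_of_subset hD.1, mul_pow]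
        have h1 : 1 ≤ (s ^ S.card)⁻¹ * s ^ D.card := by
          rw [← div_eq_inv_mul, one_le_div (by positivity)]
          exact pow_le_pow_of_le_one hs.le hs1 hD.2
        calc (p : ℝ) ^ D.card * (1 - p : ℝ) ^ (Q.card - D.card)
            ≤ ((s ^ S.card)⁻¹ * s ^ D.card) *
              ((p : ℝ) ^ D.card * (1 - p : ℝ) ^ (Q.card - D.card)) :=
              le_mul_of_one_le_left (by positivity) h1
          _ = _ := by ring
    _ ≤ ∑ D ∈ Q.powerset,
          (s ^ S.card)⁻¹ * (((p : ℝ) * s) ^ D.card * (1 - p : ℝ) ^ (Q.card - D.card)) :=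
        Finset.sum_le_sum_of_subset_of_nonneg (Finset.filter_subset _ _)
          fun D _ _ => by positivity
    _ = _ := by
        rw [← Finset.mul_sum, Finset.sum_pow_mul_eq_add_pow, hQc]

/-- The first moment bound for induced `T`-matchings: every vertex subset of one of them spans at
most as many edges as it has vertices. -/
theorem binomialRandom_real_le_maxInducedTMatchingOrder_le [Fintype V] [Finite W]
    {T : SimpleGraph W} (hT : T.IsTree) (p : unitInterval) (x : ℕ) {s : ℝ} (hs : 0 < s)
    (hs1 : s ≤ 1) :
    (G(V, p)).real {G | x ≤ maxInducedTMatchingOrder T G} ≤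
      (Fintype.card V).choose x *
        ((s ^ x)⁻¹ * ((p : ℝ) * s + (1 - p)) ^ (x.choose 2)) := by
  classical
  have hcover : {G : SimpleGraph V | x ≤ maxInducedTMatchingOrder T G} ⊆
      ⋃ S ∈ Finset.powersetCard x (Finset.univ : Finset V),
        {G : SimpleGraph V | (S.sym2.filter (· ∈ G.edgeSet)).card ≤ S.card} := by
    intro G hG
    obtain ⟨S, hS, hcard⟩ := (isGreatest_maxInducedTMatchingOrder T G).1
    have hx : x ≤ S.toFinset.card := by
      rw [← Set.ncard_eq_toFinset_card', hcard]
      exact hG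
    obtain ⟨S', hS', hS'c⟩ := Finset.exists_subset_card_eq hx
    simp only [Set.mem_iUnion]
    refine ⟨S', Finset.mem_powersetCard.2 ⟨Finset.subset_univ _, hS'c⟩, ?_⟩
    refine card_filter_edgeSet_sym2_le G S' fun J hJ hne => ?_
    have hdeg := hS.isOneDegenerate hT.isOneDegenerate
    have hJS : ∀ v ∈ J, v ∈ S := fun v hv => by simpa using hS' (hJ hv)
    obtain ⟨v₀, hv₀⟩ := hne
    obtain ⟨v, hv, huniq⟩ := hdeg {v | v.1 ∈ J} ⟨⟨v₀, hJS v₀ hv₀⟩, hv₀⟩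
    refine ⟨v.1, hv, fun u hu u' hu' h h' => ?_⟩
    have := huniq ⟨u, hJS u hu⟩ hu ⟨u', hJS u' hu'⟩ hu' h h'
    simpa using this
  calc _ ≤ _ := measureReal_mono hcover (measure_ne_top _ _)
    _ ≤ ∑ S ∈ Finset.powersetCard x (Finset.univ : Finset V), (G(V, p)).real
          {G : SimpleGraph V | (S.sym2.filter (· ∈ G.edgeSet)).card ≤ S.card} :=
        measureReal_biUnion_finset_le _ _
    _ ≤ ∑ S ∈ Finset.powersetCard x (Finset.univ : Finset V),
          ((s ^ x)⁻¹ * ((p : ℝ) * s + (1 - p)) ^ (x.choose 2)) := by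
        refine Finset.sum_le_sum fun S hS => ?_
        rw [← (Finset.mem_powersetCard.1 hS).2]
        exact binomialRandom_real_card_edges_le p S _ (fun G e => Finset.mem_filter) hs hs1
    _ = _ := by simp

end SimpleGraph

/-! ### The second moment of the number of transversal induced copies of a forest -/

namespace SimpleGraph

variable {V ι : Type*}

/-- The graphs in which the map `θ` spans an induced copy of `F`. -/
def inducedCopyEvent (F : SimpleGraph ι) (θ : ι → V) : Set (SimpleGraph V) :=
  {G | ∀ i j, G.Adj (θ i) (θ j) ↔ F.Adj i j}

/-- The image under `θ` of the edges of `F`. -/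
noncomputable def edgeImage [Fintype ι] [DecidableEq V] (F : SimpleGraph ι) (θ : ι → V) :
    Finset (Sym2 V) :=
  haveI : Fintype F.edgeSet := Fintype.ofFinite _
  F.edgeFinset.image (Sym2.map θ)

section

variable [Fintype ι] [DecidableEq V]

theorem mem_edgeImage {F : SimpleGraph ι} {θ : ι → V} {e : Sym2 V} :
    e ∈ edgeImage F θ ↔ ∃ e' ∈ F.edgeSet, e'.map θ = e := by
  simp [edgeImage]

theorem card_edgeImage (F : SimpleGraph ι) {θ θ' : ι → V} (hθ : Function.Injective θ)
    (hθ' : Function.Injective θ') : (edgeImage F θ).card = (edgeImage F θ').card := by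
  unfold edgeImage
  rw [Finset.card_image_of_injective _ (Sym2.map.injective hθ),
    Finset.card_image_of_injective _ (Sym2.map.injective hθ')]

theorem not_isDiag_of_mem_edgeImage {F : SimpleGraph ι} {θ : ι → V} (hθ : Function.Injective θ)
    {e : Sym2 V} (he : e ∈ edgeImage F θ) : ¬ e.IsDiag := by
  obtain ⟨e', he', rfl⟩ := mem_edgeImage.1 he
  rw [Sym2.isDiag_map hθ]
  exact F.not_isDiag_of_mem_edgeSet he'

theorem disjoint_edgeImage_compl {F : SimpleGraph ι} {θ : ι → V} (hθ : Function.Injective θ) :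
    Disjoint (edgeImage F θ) (edgeImage Fᶜ θ) := by
  rw [Finset.disjoint_left]
  intro e he he'
  obtain ⟨a, ha, rfl⟩ := mem_edgeImage.1 he
  obtain ⟨b, hb, hab⟩ := mem_edgeImage.1 he'
  have := Sym2.map.injective hθ hab
  subst this
  induction b with
  | _ x y =>
    rw [mem_edgeSet, compl_adj] at hb
    exact hb.2 ha

theorem inducedCopyEvent_eq (F : SimpleGraph ι) (θ : ι → V) :
    inducedCopyEvent F θ = {G | (∀ e ∈ edgeImage F θ, e ∈ G.edgeSet) ∧
      ∀ e ∈ edgeImage Fᶜ θ, e ∉ G.edgeSet} := by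
  ext G
  constructor
  · intro h
    refine ⟨fun e he => ?_, fun e he => ?_⟩
    · obtain ⟨a, ha, rfl⟩ := mem_edgeImage.1 he
      induction a with
      | _ x y => exact (h x y).2 ha
    · obtain ⟨a, ha, rfl⟩ := mem_edgeImage.1 he
      induction a with
      | _ x y =>
        rw [mem_edgeSet, compl_adj] at ha
        exact fun h' => ha.2 ((h x y).1 h')
  · rintro ⟨h1, h2⟩ i j
    constructor
    · intro h
      by_contra hF
      have hij : i ≠ j := by
        rintro rfl
        exact G.loopless.irrefl _ h
      exact h2 s(θ i, θ j) (mem_edgeImage.2 ⟨s(i, j), ⟨hij, hF⟩, rfl⟩) h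
    · intro h
      exact h1 s(θ i, θ j) (mem_edgeImage.2 ⟨s(i, j), h, rfl⟩)

/-- The probability of two induced copies of `F`, compared with that of two independent copies. -/
theorem binomialRandom_real_inter_inducedCopyEvent_le [Fintype V] (p : unitInterval)
    (hp0 : (0 : ℝ) < p) (hp1 : (p : ℝ) < 1) (F : SimpleGraph ι) {θ η : ι → V}
    (hθ : Function.Injective θ) (hη : Function.Injective η) :
    (G(V, p)).real (inducedCopyEvent F θ ∩ inducedCopyEvent F η) ≤
      (G(V, p)).real (inducedCopyEvent F θ) * (G(V, p)).real (inducedCopyEvent F η) *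
        ((p : ℝ)⁻¹ ^ (edgeImage F θ ∩ edgeImage F η).card *
          (1 - p : ℝ)⁻¹ ^ (edgeImage Fᶜ θ ∩ edgeImage Fᶜ η).card) := by
  have hp1' : (0 : ℝ) < 1 - p := sub_pos.2 hp1
  rw [inducedCopyEvent_eq F θ, inducedCopyEvent_eq F η,
    binomialRandom_real_cylinder p _ _ (disjoint_edgeImage_compl hθ)
      (fun e => not_isDiag_of_mem_edgeImage hθ) (fun e => not_isDiag_of_mem_edgeImage hθ),
    binomialRandom_real_cylinder p _ _ (disjoint_edgeImage_compl hη)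
      (fun e => not_isDiag_of_mem_edgeImage hη) (fun e => not_isDiag_of_mem_edgeImage hη)]
  by_cases hd : Disjoint (edgeImage F θ ∪ edgeImage F η) (edgeImage Fᶜ θ ∪ edgeImage Fᶜ η)
  · have hset : {G : SimpleGraph V | (∀ e ∈ edgeImage F θ, e ∈ G.edgeSet) ∧
        ∀ e ∈ edgeImage Fᶜ θ, e ∉ G.edgeSet} ∩ {G : SimpleGraph V |
          (∀ e ∈ edgeImage F η, e ∈ G.edgeSet) ∧ ∀ e ∈ edgeImage Fᶜ η, e ∉ G.edgeSet} =
        {G : SimpleGraph V | (∀ e ∈ edgeImage F θ ∪ edgeImage F η, e ∈ G.edgeSet) ∧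
          ∀ e ∈ edgeImage Fᶜ θ ∪ edgeImage Fᶜ η, e ∉ G.edgeSet} := by
      ext G
      simp only [Set.mem_inter_iff, Set.mem_ofPred_eq, Finset.mem_union]
      grind
    rw [hset, binomialRandom_real_cylinder p _ _ hd]
    · have key : ∀ (y : ℝ), 0 < y → ∀ A B : Finset (Sym2 V),
          y ^ (A ∪ B).card = y ^ A.card * y ^ B.card * y⁻¹ ^ (A ∩ B).card := by
        intro y hy A B
        rw [inv_pow, ← div_eq_mul_inv, eq_div_iff (by positivity), ← pow_add, ← pow_add,
          Finset.card_union_add_card_inter]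
      rw [key _ hp0, key _ hp1']
      apply le_of_eq
      ring
    · intro e he
      rcases Finset.mem_union.1 he with h | h
      exacts [not_isDiag_of_mem_edgeImage hθ h, not_isDiag_of_mem_edgeImage hη h]
    · intro e he
      rcases Finset.mem_union.1 he with h | h
      exacts [not_isDiag_of_mem_edgeImage hθ h, not_isDiag_of_mem_edgeImage hη h]
  · rw [Finset.not_disjoint_iff] at hd
    obtain ⟨e, he, he'⟩ := hd
    have hset : {G : SimpleGraph V | (∀ e ∈ edgeImage F θ, e ∈ G.edgeSet) ∧
        ∀ e ∈ edgeImage Fᶜ θ, e ∉ G.edgeSet} ∩ {G : SimpleGraph V |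
          (∀ e ∈ edgeImage F η, e ∈ G.edgeSet) ∧ ∀ e ∈ edgeImage Fᶜ η, e ∉ G.edgeSet} = ∅ := by
      ext G
      simp only [Set.mem_inter_iff, Set.mem_ofPred_eq, Set.mem_empty_iff_false, iff_false]
      rw [Finset.mem_union] at he he'
      grind
    rw [hset, measureReal_empty]
    positivity

/-- If two injections agree on `J` up to the reparametrization `σ`, and their images meet only in
the image of `J`, then `σ` maps the edges of the first copy that also lie in the second copy to
edges. -/
theorem card_edgeImage_inter_le [DecidableEq ι] (F : SimpleGraph ι) {θ η : ι → V}
    (hη : Function.Injective η) (J : Finset ι) (hJ : ∀ i j, θ i = η j → i ∈ J) (σ : J → ι)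
    (hσ : ∀ j : J, θ j = η (σ j)) (E : Finset (Sym2 J))
    (hE : ∀ e, e ∈ E ↔ e ∈ (F.induce (J : Set ι)).edgeSet ∧ e.map σ ∈ F.edgeSet) :
    (edgeImage F θ ∩ edgeImage F η).card ≤ E.card := by
  have hsub : edgeImage F θ ∩ edgeImage F η ⊆ E.image (Sym2.map fun j : J => θ j) := by
    intro e he
    rw [Finset.mem_inter] at he
    obtain ⟨a, ha, rfl⟩ := mem_edgeImage.1 he.1
    obtain ⟨b, hb, hab⟩ := mem_edgeImage.1 he.2
    induction a with
    | _ x y =>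
    induction b with
    | _ u v =>
    have main : ∀ x y : ι, s(x, y) ∈ F.edgeSet → θ x = η u → θ y = η v →
        Sym2.map θ s(x, y) ∈ E.image (Sym2.map fun j : J => θ j) := by
      intro x y hxy h1 h2
      refine Finset.mem_image.2 ⟨s(⟨x, hJ x u h1⟩, ⟨y, hJ y v h2⟩), (hE _).2 ⟨hxy, ?_⟩, rfl⟩
      have e1 : σ ⟨x, hJ x u h1⟩ = u := hη ((hσ _).symm.trans h1)
      have e2 : σ ⟨y, hJ y v h2⟩ = v := hη ((hσ _).symm.trans h2)
      rw [Sym2.map_mk, e1, e2]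
      exact hb
    simp only [Sym2.map_mk, Sym2.eq_iff] at hab
    rcases hab with ⟨h1, h2⟩ | ⟨h1, h2⟩
    · exact main x y ha h1.symm h2.symm
    · have := main y x (by rwa [Sym2.eq_swap]) h1.symm h2.symm
      rwa [Sym2.eq_swap] at this
  exact (Finset.card_le_card hsub).trans Finset.card_image_le

theorem card_edgeImage_inter_le_choose (F : SimpleGraph ι) {θ η : ι → V}
    (J : Finset ι) (hJ : ∀ i j, θ i = η j → i ∈ J) :
    (edgeImage F θ ∩ edgeImage F η).card ≤ (J.card + 1).choose 2 := by
  have hsub : edgeImage F θ ∩ edgeImage F η ⊆ J.sym2.image (Sym2.map θ) := by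
    intro e he
    rw [Finset.mem_inter] at he
    obtain ⟨a, ha, rfl⟩ := mem_edgeImage.1 he.1
    obtain ⟨b, hb, hab⟩ := mem_edgeImage.1 he.2
    induction a with
    | _ x y =>
    induction b with
    | _ u v =>
    refine Finset.mem_image.2 ⟨s(x, y), Finset.mk_mem_sym2_iff.2 ?_, rfl⟩
    simp only [Sym2.map_mk, Sym2.eq_iff] at hab
    rcases hab with ⟨h1, h2⟩ | ⟨h1, h2⟩
    · exact ⟨hJ _ _ h1.symm, hJ _ _ h2.symm⟩
    · exact ⟨hJ _ _ h2.symm, hJ _ _ h1.symm⟩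
  exact (Finset.card_le_card hsub).trans (Finset.card_image_le.trans (Finset.card_sym2 J).le)

end

/-- The number of pairs of an embedding and a function on `ι` with prescribed restriction to `J`. -/
theorem card_filter_extend_le [Fintype ι] [DecidableEq ι] {K N : ℕ} (J : Finset ι)
    (g : J → Fin K) (h : J → Fin N) :
    (Finset.univ.filter fun φ : (ι ↪ Fin K) × (ι → Fin N) =>
      ∀ j : J, φ.1 j = g j ∧ φ.2 j = h j).card ≤
      (K - J.card).descFactorial (Fintype.card ι - J.card) * N ^ (Fintype.card ι - J.card) := by
  classical
  rcases Finset.eq_empty_or_nonempty (Finset.univ.filter fun φ : (ι ↪ Fin K) × (ι → Fin N) =>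
      ∀ j : J, φ.1 j = g j ∧ φ.2 j = h j) with h0 | ⟨φ₀, hφ₀⟩
  · rw [h0, Finset.card_empty]
    exact Nat.zero_le _
  have hg : Function.Injective g := by
    intro a b hab
    have := (Finset.mem_filter.1 hφ₀).2
    rw [← (this a).1, ← (this b).1] at hab
    exact Subtype.ext (φ₀.1.injective hab)
  have hc1 : Fintype.card {i // i ∉ J} = Fintype.card ι - J.card := by
    rw [Fintype.card_subtype_compl]; simp
  have hc2 : Fintype.card {a // a ∉ Set.range g} = K - J.card := by
    rw [Fintype.card_subtype_compl, Fintype.card_fin, ← Nat.card_eq_fintype_card]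
    congr 1
    exact (Nat.card_range_of_injective hg).trans (by simp)
  have hcard : Fintype.card (({i // i ∉ J} ↪ {a // a ∉ Set.range g}) × ({i // i ∉ J} → Fin N)) =
      (K - J.card).descFactorial (Fintype.card ι - J.card) * N ^ (Fintype.card ι - J.card) := by
    rw [Fintype.card_prod, Fintype.card_embedding_eq, Fintype.card_fun, hc1, hc2, Fintype.card_fin]
  rw [← hcard, ← Fintype.card_coe]
  refine Fintype.card_le_of_injective (fun φ => (⟨fun i => ⟨φ.1.1 i.1, ?_⟩, ?_⟩,
    fun i => φ.1.2 i.1)) ?_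
  · rintro ⟨j, hj⟩
    rw [← ((Finset.mem_filter.1 φ.2).2 j).1] at hj
    exact i.2 (φ.1.1.injective hj ▸ j.2)
  · intro a b hab
    exact Subtype.ext (φ.1.1.injective (Subtype.ext_iff.1 hab))
  · rintro ⟨φ, hφ⟩ ⟨ψ, hψ⟩ heq
    have hφ' := (Finset.mem_filter.1 hφ).2
    have hψ' := (Finset.mem_filter.1 hψ).2
    rw [Prod.mk.injEq] at heq
    obtain ⟨h1, h2⟩ := heq
    have e1 : φ.1 = ψ.1 := by
      ext i
      by_cases hi : i ∈ J
      · rw [(hφ' ⟨i, hi⟩).1, (hψ' ⟨i, hi⟩).1]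
      · have := DFunLike.congr_fun h1 ⟨i, hi⟩
        have := Subtype.ext_iff.1 this
        exact congrArg _ this
    have e2 : φ.2 = ψ.2 := by
      funext i
      by_cases hi : i ∈ J
      · rw [(hφ' ⟨i, hi⟩).2, (hψ' ⟨i, hi⟩).2]
      · exact congr_fun h2 ⟨i, hi⟩
    exact Subtype.ext (Prod.ext e1 e2)

/-- A transversal placement: the vertex `i` is sent to the vertex number `φ.2 i` of the block
number `φ.1 i`, distinct vertices being sent to distinct blocks. -/
def place {K N : ℕ} (b : Fin K × Fin N ↪ V) (φ : (ι ↪ Fin K) × (ι → Fin N)) (i : ι) : V :=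
  b (φ.1 i, φ.2 i)

theorem place_injective {K N : ℕ} (b : Fin K × Fin N ↪ V) (φ : (ι ↪ Fin K) × (ι → Fin N)) :
    Function.Injective (place b φ) := by
  intro i j h
  have := b.injective h
  exact φ.1.injective (Prod.ext_iff.1 this).1

/-- The sum of the correlations with one fixed placement `ψ`. It is organized by the set `J` of
vertices that are placed on vertices used by `ψ`, and by the map `σ` that tells how they are placed
there. -/
theorem sum_correlation_le [Fintype V] [DecidableEq V] [Fintype ι] [DecidableEq ι] {K N : ℕ}
    (b : Fin K × Fin N ↪ V) (F : SimpleGraph ι) (hF : F.IsOneDegenerate) (Δ : ℕ)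
    [DecidableRel F.Adj] (hΔ : ∀ c, (Finset.univ.filter (F.Adj c)).card ≤ Δ)
    {x q : ℝ} (hx : 1 ≤ x) (hq : 1 ≤ q) (ψ : (ι ↪ Fin K) × (ι → Fin N)) :
    ∑ φ : (ι ↪ Fin K) × (ι → Fin N),
      x ^ (edgeImage F (place b φ) ∩ edgeImage F (place b ψ)).card *
        q ^ (edgeImage Fᶜ (place b φ) ∩ edgeImage Fᶜ (place b ψ)).card ≤
      ∑ J : Finset ι, q ^ (J.card + 1).choose 2 * (Fintype.card ι + Δ * x) ^ J.card *
        ((K - J.card).descFactorial (Fintype.card ι - J.card) *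
          N ^ (Fintype.card ι - J.card) : ℕ) := by
  classical
  have hx0 : (0 : ℝ) ≤ x := by linarith
  have hq0 : (0 : ℝ) ≤ q := by linarith
  let E : (J : Finset ι) → (J → ι) → Finset (Sym2 J) := fun J σ =>
    (Finset.univ : Finset J).sym2.filter fun e =>
      e ∈ (F.induce (J : Set ι)).edgeSet ∧ e.map σ ∈ F.edgeSet
  have h1 : ∀ φ : (ι ↪ Fin K) × (ι → Fin N),
      x ^ (edgeImage F (place b φ) ∩ edgeImage F (place b ψ)).card *
        q ^ (edgeImage Fᶜ (place b φ) ∩ edgeImage Fᶜ (place b ψ)).card ≤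
      ∑ J : Finset ι, ∑ σ : J → ι, q ^ (J.card + 1).choose 2 * x ^ (E J σ).card *
        if ∀ j : J, φ.1 j = ψ.1 (σ j) ∧ φ.2 j = ψ.2 (σ j) then 1 else 0 := by
    intro φ
    set J : Finset ι := Finset.univ.filter fun i => ∃ j, place b φ i = place b ψ j with hJdef
    have hJ : ∀ i j, place b φ i = place b ψ j → i ∈ J := fun i j h => by
      rw [hJdef, Finset.mem_filter]
      exact ⟨Finset.mem_univ _, j, h⟩
    have hex : ∀ j : J, ∃ i, place b φ j = place b ψ i := fun j => by
      have h : ∀ i ∈ J, ∃ i', place b φ i = place b ψ i' := fun i hi =>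
        (Finset.mem_filter.1 hi).2
      exact h j j.2
    choose σ hσ using hex
    have hmatch : ∀ j : J, φ.1 j = ψ.1 (σ j) ∧ φ.2 j = ψ.2 (σ j) := fun j => by
      have := b.injective (hσ j)
      simpa using this
    have hterm : x ^ (edgeImage F (place b φ) ∩ edgeImage F (place b ψ)).card *
        q ^ (edgeImage Fᶜ (place b φ) ∩ edgeImage Fᶜ (place b ψ)).card ≤
        q ^ (J.card + 1).choose 2 * x ^ (E J σ).card *
        if ∀ j : J, φ.1 j = ψ.1 (σ j) ∧ φ.2 j = ψ.2 (σ j) then 1 else 0 := by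
      rw [if_pos hmatch, mul_one, mul_comm]
      gcongr
      · exact card_edgeImage_inter_le_choose Fᶜ J hJ
      · refine card_edgeImage_inter_le F (place_injective b ψ) J hJ σ hσ _ fun e => ?_
        simp only [E, Finset.mem_filter, Finset.mem_sym2_iff, Finset.mem_univ, implies_true,
          true_and]
    refine hterm.trans ?_
    have hnn : ∀ (J : Finset ι) (σ : J → ι), 0 ≤ q ^ (J.card + 1).choose 2 * x ^ (E J σ).card *
        (if ∀ j : J, φ.1 j = ψ.1 (σ j) ∧ φ.2 j = ψ.2 (σ j) then 1 else 0 : ℝ) := by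
      intro J σ
      positivity
    refine le_trans ?_ (Finset.single_le_sum (f := fun J : Finset ι => ∑ σ : J → ι,
      q ^ (J.card + 1).choose 2 * x ^ (E J σ).card *
        (if ∀ j : J, φ.1 j = ψ.1 (σ j) ∧ φ.2 j = ψ.2 (σ j) then 1 else 0 : ℝ))
      (fun J _ => Finset.sum_nonneg fun σ _ => hnn J σ) (Finset.mem_univ J))
    exact Finset.single_le_sum (f := fun σ : J → ι =>
      q ^ (J.card + 1).choose 2 * x ^ (E J σ).card *
        (if ∀ j : J, φ.1 j = ψ.1 (σ j) ∧ φ.2 j = ψ.2 (σ j) then 1 else 0 : ℝ))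
      (fun σ _ => hnn J σ) (Finset.mem_univ σ)
  refine (Finset.sum_le_sum fun φ _ => h1 φ).trans ?_
  rw [Finset.sum_comm]
  refine Finset.sum_le_sum fun J _ => ?_
  rw [Finset.sum_comm]
  set ext : ℕ := (K - J.card).descFactorial (Fintype.card ι - J.card) *
    N ^ (Fintype.card ι - J.card) with hext
  have h2 : ∀ σ : J → ι, ∑ φ : (ι ↪ Fin K) × (ι → Fin N),
      q ^ (J.card + 1).choose 2 * x ^ (E J σ).card *
        (if ∀ j : J, φ.1 j = ψ.1 (σ j) ∧ φ.2 j = ψ.2 (σ j) then 1 else 0 : ℝ) ≤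
      q ^ (J.card + 1).choose 2 * x ^ (E J σ).card * ext := by
    intro σ
    rw [← Finset.mul_sum, Finset.sum_boole]
    gcongr
    exact card_filter_extend_le J (fun j => ψ.1 (σ j)) fun j => ψ.2 (σ j)
  refine (Finset.sum_le_sum fun σ _ => h2 σ).trans ?_
  rw [← Finset.sum_mul, ← Finset.mul_sum]
  gcongr
  have h3 := card_pow_mul_sum_pow_le (F.induce (J : Set ι)) F (hF.induce _) Δ hΔ hx
    (Finset.univ : Finset J)
  have hJc : Fintype.card (J : Set ι) = J.card := Fintype.card_coe J
  rw [Finset.card_univ, hJc, mul_comm] at h3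
  rcases J.eq_empty_or_nonempty with hJ | ⟨i, hi⟩
  · subst hJ
    simp [E]
  have : Nonempty ι := ⟨i⟩
  have hpos : (0 : ℝ) < (Fintype.card ι : ℝ) ^ J.card := by
    have := Fintype.card_pos (α := ι)
    positivity
  exact le_of_mul_le_mul_right h3 hpos

/-- The second moment bound: if there are `2 k` blocks of size `N`, then a transversal induced copy of
the forest `F` on `k` vertices exists with probability at least the reciprocal of a sum, whose index
`i` stands for the number of common vertices of two copies. -/
theorem one_div_le_binomialRandom_real_iUnion [Fintype V] [Fintype ι] [Nonempty ι] {k N : ℕ}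
    (hk : Fintype.card ι = k) (hN : 0 < N) (b : Fin (2 * k) × Fin N ↪ V) (F : SimpleGraph ι)
    (hF : F.IsOneDegenerate) (Δ : ℕ) [DecidableRel F.Adj]
    (hΔ : ∀ c, (Finset.univ.filter (F.Adj c)).card ≤ Δ) (p : unitInterval)
    (hp0 : (0 : ℝ) < p) (hp1 : (p : ℝ) < 1) :
    1 / (∑ i ∈ Finset.range (k + 1), k.choose i *
      ((1 - p : ℝ)⁻¹ ^ (i + 1).choose 2 * ((k + Δ * (p : ℝ)⁻¹) / (k * N)) ^ i)) ≤
      (G(V, p)).real (⋃ φ : (ι ↪ Fin (2 * k)) × (ι → Fin N),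
        inducedCopyEvent F (place b φ)) := by
  classical
  have hk0 : 0 < k := hk ▸ Fintype.card_pos
  set x : ℝ := (p : ℝ)⁻¹ with hx
  set q : ℝ := (1 - p : ℝ)⁻¹ with hq
  have hx1 : 1 ≤ x := (one_le_inv₀ hp0).2 hp1.le
  have hq1 : 1 ≤ q := (one_le_inv₀ (by linarith)).2 (by linarith)
  set M : ℕ := (2 * k).descFactorial k * N ^ k with hM
  have hM0 : 0 < M := Nat.mul_pos (Nat.descFactorial_pos.2 (by omega)) (pow_pos hN k)
  have hMc : Fintype.card ((ι ↪ Fin (2 * k)) × (ι → Fin N)) = M := by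
    rw [Fintype.card_prod, Fintype.card_embedding_eq, Fintype.card_fun, Fintype.card_fin,
      Fintype.card_fin, hk]
  -- all placements have the same probability
  obtain ⟨μ, hμ0, hμ⟩ : ∃ μ : ℝ, 0 < μ ∧ ∀ φ : (ι ↪ Fin (2 * k)) × (ι → Fin N),
      (G(V, p)).real (inducedCopyEvent F (place b φ)) = μ := by
    have hne : Nonempty ((ι ↪ Fin (2 * k)) × (ι → Fin N)) := by
      rw [← Fintype.card_pos_iff, hMc]
      exact hM0
    obtain ⟨φ₀⟩ := hne
    refine ⟨(p : ℝ) ^ (edgeImage F (place b φ₀)).card *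
      (1 - p : ℝ) ^ (edgeImage Fᶜ (place b φ₀)).card, ?_, fun φ => ?_⟩
    · have : (0 : ℝ) < 1 - p := sub_pos.2 hp1
      positivity
    · rw [inducedCopyEvent_eq F (place b φ),
        binomialRandom_real_cylinder p _ _ (disjoint_edgeImage_compl (place_injective b φ))
        (fun e => not_isDiag_of_mem_edgeImage (place_injective b φ))
        (fun e => not_isDiag_of_mem_edgeImage (place_injective b φ)),
        card_edgeImage F (place_injective b φ) (place_injective b φ₀),
        card_edgeImage Fᶜ (place_injective b φ) (place_injective b φ₀)]
  have hΔ0 : (0 : ℝ) ≤ Δ := by positivity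
  have hsum : ∑ φ : (ι ↪ Fin (2 * k)) × (ι → Fin N),
      (G(V, p)).real (inducedCopyEvent F (place b φ)) = M * μ := by

    rw [Finset.sum_congr rfl fun φ _ => hμ φ, Finset.sum_const, Finset.card_univ, hMc,
      nsmul_eq_mul]
  have hNR : (0 : ℝ) < N := by exact_mod_cast hN
  have hkR : (0 : ℝ) < k := by exact_mod_cast hk0
  refine one_div_le_measureReal_iUnion (G(V, p)) _ ?_ ?_ ?_
  · have hterm : ∀ i ∈ Finset.range (k + 1), 0 < (k.choose i : ℝ) *
      (q ^ (i + 1).choose 2 * ((k + Δ * x) / (k * N)) ^ i) := by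
      intro i hi
      have := Nat.choose_pos (Nat.lt_succ_iff.1 (Finset.mem_range.1 hi))
      positivity
    exact Finset.sum_pos hterm ⟨0, by simp⟩
  · rw [hsum]
    positivity
  · rw [hsum]
    -- the number of extensions of a placement of `J`, as a fraction of all placements
    have hext : ∀ J : Finset ι,
        (((2 * k - J.card).descFactorial (k - J.card) * N ^ (k - J.card) : ℕ) : ℝ) ≤
          M * ((k * N : ℝ) ^ J.card)⁻¹ := by
      intro J
      have hJk : J.card ≤ k := hk ▸ Finset.card_le_univ J
      rw [← div_eq_mul_inv, le_div_iff₀ (by positivity)]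
      have h1 : k ^ J.card ≤ (2 * k).descFactorial J.card :=
        (Nat.pow_le_pow_left (by omega) _).trans (Nat.pow_sub_le_descFactorial (2 * k) J.card)
      have h2 : (2 * k - J.card).descFactorial (k - J.card) * N ^ (k - J.card) *
          (k * N) ^ J.card ≤ M := by
        calc _ = ((2 * k - J.card).descFactorial (k - J.card) * k ^ J.card) *
              (N ^ (k - J.card) * N ^ J.card) := by ring
          _ ≤ ((2 * k - J.card).descFactorial (k - J.card) * (2 * k).descFactorial J.card) *
              (N ^ (k - J.card) * N ^ J.card) := by gcongr
          _ = M := by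
              rw [Nat.descFactorial_mul_descFactorial hJk, ← pow_add, Nat.sub_add_cancel hJk]
      exact_mod_cast h2
    have hψ : ∀ ψ : (ι ↪ Fin (2 * k)) × (ι → Fin N),
        ∑ φ : (ι ↪ Fin (2 * k)) × (ι → Fin N), (G(V, p)).real
          (inducedCopyEvent F (place b φ) ∩ inducedCopyEvent F (place b ψ)) ≤
        μ ^ 2 * (M * ∑ i ∈ Finset.range (k + 1), k.choose i *
          (q ^ (i + 1).choose 2 * ((k + Δ * x) / (k * N)) ^ i)) := by
      intro ψ
      calc _ ≤ ∑ φ : (ι ↪ Fin (2 * k)) × (ι → Fin N), μ ^ 2 *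
            (x ^ (edgeImage F (place b φ) ∩ edgeImage F (place b ψ)).card *
              q ^ (edgeImage Fᶜ (place b φ) ∩ edgeImage Fᶜ (place b ψ)).card) := by
            refine Finset.sum_le_sum fun φ _ => ?_
            have := binomialRandom_real_inter_inducedCopyEvent_le p hp0 hp1 F
              (place_injective b φ) (place_injective b ψ)
            rw [hμ, hμ, ← sq] at this
            exact this
        _ ≤ μ ^ 2 * ∑ J : Finset ι, q ^ (J.card + 1).choose 2 * (k + Δ * x) ^ J.card *
              ((2 * k - J.card).descFactorial (k - J.card) * N ^ (k - J.card) : ℕ) := by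
            rw [← Finset.mul_sum]
            gcongr
            have := sum_correlation_le b F hF Δ hΔ hx1 hq1 ψ
            rwa [hk] at this
        _ ≤ μ ^ 2 * ∑ J : Finset ι, q ^ (J.card + 1).choose 2 * (k + Δ * x) ^ J.card *
              (M * ((k * N : ℝ) ^ J.card)⁻¹) := by
            gcongr with J
            exact hext J
        _ = μ ^ 2 * ∑ J ∈ (Finset.univ : Finset ι).powerset,
              M * (q ^ (J.card + 1).choose 2 * ((k + Δ * x) / (k * N)) ^ J.card) := by
            rw [Finset.powerset_univ]
            congr 1
            refine Finset.sum_congr rfl fun J _ => ?_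
            rw [div_pow]
            ring
        _ = _ := by
            rw [Finset.sum_powerset_apply_card (fun i =>
              (M : ℝ) * (q ^ (i + 1).choose 2 * ((k + Δ * x) / (k * N)) ^ i)),
              Finset.card_univ, hk, Finset.mul_sum _ _ (M : ℝ)]
            congr 1
            refine Finset.sum_congr rfl fun i _ => ?_
            rw [nsmul_eq_mul]
            ring
    rw [Finset.sum_comm]
    refine (Finset.sum_le_sum fun ψ _ => hψ ψ).trans ?_
    rw [Finset.sum_const, Finset.card_univ, hMc, nsmul_eq_mul]
    apply le_of_eq
    ring

end SimpleGraph

/-! ### The number of copies in a transversal `T`-matching -/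

namespace SimpleGraph

variable {V W : Type*}

/-- The placement `φ` of `m` copies of `T` spans induced copies, without edges in between, on the
copies with index in `A`. -/
def IsPartialCopy {m K N : ℕ} (T : SimpleGraph W) (b : Fin K × Fin N ↪ V) (G : SimpleGraph V)
    (φ : (Fin m × W ↪ Fin K) × (Fin m × W → Fin N)) (A : Finset (Fin m)) : Prop :=
  ∀ i j, i.1 ∈ A → j.1 ∈ A → (G.Adj (place b φ i) (place b φ j) ↔ (copies (Fin m) T).Adj i j)

open Classical in
/-- The largest number of copies of `T`, but at most `m`, in a transversal induced `T`-matching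
of `G`. -/
noncomputable def transversalCopies [Fintype W] {K N : ℕ} (m : ℕ) (T : SimpleGraph W)
    (b : Fin K × Fin N ↪ V) (G : SimpleGraph V) : ℕ :=
  (Finset.univ.filter fun x : ((Fin m × W ↪ Fin K) × (Fin m × W → Fin N)) × Finset (Fin m) =>
    IsPartialCopy T b G x.1 x.2).sup fun x => x.2.card

section

variable [Fintype W] {m K N : ℕ} {T : SimpleGraph W} {b : Fin K × Fin N ↪ V}

theorem le_transversalCopies {G : SimpleGraph V}
    {φ : (Fin m × W ↪ Fin K) × (Fin m × W → Fin N)} {A : Finset (Fin m)}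
    (h : IsPartialCopy T b G φ A) : A.card ≤ transversalCopies m T b G := by
  classical
  exact Finset.le_sup (f := fun x : ((Fin m × W ↪ Fin K) × (Fin m × W → Fin N)) ×
    Finset (Fin m) => x.2.card) (Finset.mem_filter.2 ⟨Finset.mem_univ (φ, A), h⟩)

theorem exists_isPartialCopy {G : SimpleGraph V} (h : 0 < transversalCopies m T b G) :
    ∃ (φ : (Fin m × W ↪ Fin K) × (Fin m × W → Fin N)) (A : Finset (Fin m)),
      IsPartialCopy T b G φ A ∧ A.card = transversalCopies m T b G := by
  classical
  have hne : (Finset.univ.filter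
      fun x : ((Fin m × W ↪ Fin K) × (Fin m × W → Fin N)) × Finset (Fin m) =>
        IsPartialCopy T b G x.1 x.2).Nonempty := by
    by_contra hne
    rw [Finset.not_nonempty_iff_eq_empty] at hne
    rw [transversalCopies, hne] at h
    simp at h
  obtain ⟨x, hx, hx'⟩ := Finset.exists_mem_eq_sup _ hne
    (fun x : ((Fin m × W ↪ Fin K) × (Fin m × W → Fin N)) × Finset (Fin m) => x.2.card)
  exact ⟨x.1, x.2, (Finset.mem_filter.1 hx).2, hx'.symm⟩

theorem transversalCopies_mul_card_le [Finite V] (hT : T.Connected) (G : SimpleGraph V) :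
    transversalCopies m T b G * Fintype.card W ≤ maxInducedTMatchingOrder T G := by
  rcases Nat.eq_zero_or_pos (transversalCopies m T b G) with h | h
  · rw [h, zero_mul]
    exact Nat.zero_le _
  obtain ⟨φ, A, hA, hc⟩ := exists_isPartialCopy h
  have := card_mul_card_le_maxInducedTMatchingOrder (α := A) hT G
    (fun x => place b φ (x.1.1, x.2))
    (fun x y hxy => by
      have := place_injective b φ hxy
      rw [Prod.mk.injEq] at this
      exact Prod.ext (Subtype.ext this.1) this.2)
    (fun x y => by
      rw [hA _ _ x.1.2 y.1.2, copies_adj, copies_adj, Subtype.ext_iff])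
  rwa [Fintype.card_coe, hc] at this

/-- If two graphs differ only in pairs whose later block is the block `a`, then it suffices to
remove the copy of `T` that meets this block. -/
theorem transversalCopies_le_add_one (blk : V → ℕ) (hblk : ∀ y, blk (b y) = y.1) (a : ℕ)
    (G H : SimpleGraph V)
    (hGH : ∀ u v, max (blk u) (blk v) ≠ a → (G.Adj u v ↔ H.Adj u v)) :
    transversalCopies m T b G ≤ transversalCopies m T b H + 1 := by
  classical
  rcases Nat.eq_zero_or_pos (transversalCopies m T b G) with h | h
  · omega
  obtain ⟨φ, A, hA, hc⟩ := exists_isPartialCopy h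
  set A' : Finset (Fin m) := A.filter fun α => ∀ w, (φ.1 (α, w) : ℕ) ≠ a with hA'
  have hcopy : IsPartialCopy T b H φ A' := by
    intro i j hi hj
    rw [hA', Finset.mem_filter] at hi hj
    rw [← hA i j hi.1 hj.1, hGH]
    simp only [place, hblk]
    have h1 := hi.2 i.2
    have h2 := hj.2 j.2
    rcases max_choice (φ.1 i : ℕ) (φ.1 j) with h | h <;> rw [h] <;> assumption
  have hrem : (A.filter fun α => ¬ ∀ w, (φ.1 (α, w) : ℕ) ≠ a).card ≤ 1 := by
    rw [Finset.card_le_one]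
    intro α hα β hβ
    simp only [Finset.mem_filter, not_forall, not_not] at hα hβ
    obtain ⟨_, w, hw⟩ := hα
    obtain ⟨_, w', hw'⟩ := hβ
    have := φ.1.injective (Fin.ext (hw.trans hw'.symm))
    exact (Prod.mk.inj this).1
  have hsum := Finset.card_filter_add_card_filter_not (s := A)
    (fun α => ∀ w, (φ.1 (α, w) : ℕ) ≠ a)
  have := le_transversalCopies hcopy
  rw [hA'] at this
  omega

/-- If `m` copies of `T` span an induced `T`-matching at least with probability `1 / B`, by the
second moment bound, then bounded differences show that a `T`-matching with fewer than `m - r`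
copies is unlikely to be a largest one. -/
theorem binomialRandom_real_maxInducedTMatchingOrder_lt_le [Fintype V] [Nonempty W]
    (hT : T.IsTree) {k m N : ℕ} (hk : m * Fintype.card W = k) (hm : 0 < m) (hN : 0 < N)
    (b : Fin (2 * k) × Fin N ↪ V) (blk : V → ℕ) (hblk : ∀ y, blk (b y) = y.1)
    (hblk' : ∀ v, blk v < 2 * k) (p : unitInterval)
    (hp0 : (0 : ℝ) < p) (hp1 : (p : ℝ) < 1) {r : ℝ} (hr : 0 ≤ r) {B : ℝ} (hB : 0 < B)
    (hBle : ∑ i ∈ Finset.range (k + 1), k.choose i *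
      ((1 - p : ℝ)⁻¹ ^ (i + 1).choose 2 *
        ((k + Fintype.card W * (p : ℝ)⁻¹) / (k * N)) ^ i) ≤ B) :
    (G(V, p)).real {G | (maxInducedTMatchingOrder T G : ℝ) < Fintype.card W * (m - r)} ≤
      B * Real.exp (-r ^ 2 / (4 * k)) := by
  classical
  have : NeZero m := ⟨hm.ne'⟩
  have hcard : Fintype.card (Fin m × W) = k := by rw [Fintype.card_prod, Fintype.card_fin, hk]
  have hdeg : (copies (Fin m) T).IsOneDegenerate :=
    (isTMatching_copies hT.connected).isOneDegenerate hT.isOneDegenerate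
  have hΔ : ∀ c, (Finset.univ.filter ((copies (Fin m) T).Adj c)).card ≤ Fintype.card W := by
    intro c
    calc _ ≤ (Finset.univ.image fun w : W => (c.1, w)).card := by
          apply Finset.card_le_card
          intro y hy
          rw [Finset.mem_filter, copies_adj] at hy
          exact Finset.mem_image.2 ⟨y.2, Finset.mem_univ _, Prod.ext hy.2.1 rfl⟩
      _ ≤ _ := Finset.card_image_le
  have hsec := one_div_le_binomialRandom_real_iUnion hcard hN b (copies (Fin m) T) hdeg
    (Fintype.card W) hΔ p hp0 hp1
  set S : ℝ := ∑ i ∈ Finset.range (k + 1), k.choose i *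
      ((1 - p : ℝ)⁻¹ ^ (i + 1).choose 2 *
        ((k + Fintype.card W * (p : ℝ)⁻¹) / (k * N)) ^ i) with hS
  have hS0 : 0 < S := by
    have hp1' : (0 : ℝ) < 1 - p := sub_pos.2 hp1
    have hk0 : 0 < k := hk ▸ Nat.mul_pos hm Fintype.card_pos
    have hkR : (0 : ℝ) < k := by exact_mod_cast hk0
    have hNR : (0 : ℝ) < N := by exact_mod_cast hN
    refine Finset.sum_pos (fun i hi => ?_) ⟨0, by simp⟩
    have := Nat.choose_pos (Nat.lt_succ_iff.1 (Finset.mem_range.1 hi))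
    positivity
  set f : SimpleGraph V → ℝ := fun G => transversalCopies m T b G with hf
  have hlow : 1 / B ≤ (G(V, p)).real {G | (m : ℝ) ≤ f G} := by
    calc 1 / B ≤ 1 / S := by gcongr
      _ ≤ _ := hsec
      _ ≤ _ := by
          refine measureReal_mono ?_ (measure_ne_top _ _)
          intro G hG
          obtain ⟨φ, hφ⟩ := Set.mem_iUnion.1 hG
          have h : IsPartialCopy T b G φ Finset.univ := fun i j _ _ => hφ i j
          have := le_transversalCopies h
          rw [Finset.card_univ, Fintype.card_fin] at this
          exact (Nat.cast_le (α := ℝ)).2 this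
  let c : Sym2 V → ℕ := Sym2.lift ⟨fun u v => max (blk u) (blk v), fun u v => max_comm _ _⟩
  have hc : ∀ e, c e < 2 * k := by
    intro e
    induction e with
    | _ u v => exact max_lt (hblk' u) (hblk' v)
  have hconc := binomialRandom_real_ge_mul_le_le p c hc f (fun a G H hGH => by
      have := transversalCopies_le_add_one (m := m) (T := T) blk hblk a G H
        fun u v huv => hGH s(u, v) huv
      simp only [hf]
      exact_mod_cast this) (a := m) (b := m - r) (by linarith)
  have hsub : (G(V, p)).real
      {G | (maxInducedTMatchingOrder T G : ℝ) < Fintype.card W * (m - r)} ≤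
      (G(V, p)).real {G | f G ≤ m - r} := by
    refine measureReal_mono ?_ (measure_ne_top _ _)
    intro G hG
    have h1 : (transversalCopies m T b G : ℝ) * Fintype.card W ≤ maxInducedTMatchingOrder T G := by
      exact_mod_cast transversalCopies_mul_card_le hT.connected G
    have h2 : (0 : ℝ) < Fintype.card W := by exact_mod_cast Fintype.card_pos (α := W)
    have h3 : (Fintype.card W : ℝ) * f G < Fintype.card W * (m - r) := by
      rw [mul_comm]
      exact h1.trans_lt hG
    exact (lt_of_mul_lt_mul_left h3 h2.le).le
  refine hsub.trans ?_
  have h4 : 1 / B * (G(V, p)).real {G | f G ≤ m - r} ≤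
      Real.exp (-(m - (m - r)) ^ 2 / (2 * (2 * k : ℕ))) :=
    (mul_le_mul_of_nonneg_right hlow measureReal_nonneg).trans hconc
  have h5 : -((m : ℝ) - (m - r)) ^ 2 / (2 * (2 * k : ℕ)) = -r ^ 2 / (4 * k) := by
    push_cast
    ring
  rw [h5, one_div, ← div_eq_inv_mul, div_le_iff₀ hB] at h4
  linarith

end

end SimpleGraph

/-! ### Estimates -/

/-- The second moment sum is subexponential in `k`. Here `u = log (n p)` and `l = log (1 / (1 - p))`.
For `i ≤ k / 2` the term is at most `(1 + A) ^ k` with a small `A`, as `q ^ (i / 2) ≤ (n p) ^ (1 / 2)`;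
for `i > k / 2` the binomial coefficient is at most `4 ^ i` and each term is at most `1`, as
`q ^ (k / 2)` is still smaller than `n p` by a power of `n p`. -/
theorem sum_choose_mul_pow_le {k N n t : ℕ} {p l u a δ : ℝ} (hk : 0 < k) (hn : 0 < n) (hp : 0 < p)
    (hl0 : 0 ≤ l) (hq : (1 - p)⁻¹ = Real.exp l) (hl : Real.exp (l / 2) ≤ 10)
    (hu : Real.exp u = n * p) (hkl : k * l ≤ (2 - a) * u) (hkp : k * p ≤ 2 * u) (hkp1 : 1 ≤ k * p)
    (hN : (n : ℝ) ≤ 4 * (k * N)) (ha : 0 < a) (hδ : 0 < δ)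
    (h1 : 80 * (1 + t) * u * Real.exp (-(1 / 2) * u) ≤ δ)
    (h2 : 320 * (1 + t) * u * Real.exp (-(a / 2) * u) ≤ 1) :
    ∑ i ∈ Finset.range (k + 1), (k.choose i : ℝ) *
      ((1 - p)⁻¹ ^ (i + 1).choose 2 * ((k + t * p⁻¹) / (k * N)) ^ i) ≤
      (k + 1) * Real.exp (δ * k) := by
  have hkR : (0 : ℝ) < k := by exact_mod_cast hk
  have hnR : (0 : ℝ) < n := by exact_mod_cast hn
  have hu0 : 0 < u := by nlinarith
  have htR : (0 : ℝ) ≤ t := by positivity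
  have hkN : (0 : ℝ) < k * N := by nlinarith
  set R : ℝ := (k + t * p⁻¹) / (k * N) with hR
  have hR0 : 0 ≤ R := by positivity
  have hRle : R ≤ 8 * (1 + t) * u * Real.exp (-u) := by
    have e1 : k + t * p⁻¹ ≤ (1 + t) * k := by
      have : p⁻¹ ≤ k := (inv_le_iff_one_le_mul₀ hp).2 hkp1
      nlinarith
    have e2 : (1 + t) * (k : ℝ) ≤ (1 + t) * (2 * u / p) := by
      gcongr
      rw [le_div_iff₀ hp]
      exact hkp
    rw [hR, div_le_iff₀ hkN, Real.exp_neg, hu]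
    calc _ ≤ (1 + t) * (2 * u / p) := e1.trans e2
      _ = 2 * (1 + t) * u * (n * p)⁻¹ * n := by field_simp
      _ ≤ 2 * (1 + t) * u * (n * p)⁻¹ * (4 * (k * N)) := by gcongr
      _ = _ := by ring
  have hterm : ∀ i ∈ Finset.range (k + 1), (k.choose i : ℝ) *
      ((1 - p)⁻¹ ^ (i + 1).choose 2 * R ^ i) ≤ Real.exp (δ * k) := by
    intro i hi
    have hik : i ≤ k := Nat.lt_succ_iff.1 (Finset.mem_range.1 hi)
    have hikR : (i : ℝ) ≤ k := by exact_mod_cast hik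
    set A : ℝ := Real.exp (l * (i + 1) / 2) * R with hA
    have hA0 : 0 ≤ A := by positivity
    have hpow : (1 - p)⁻¹ ^ (i + 1).choose 2 * R ^ i = A ^ i := by
      rw [hA, mul_pow, hq, ← Real.exp_nat_mul, ← Real.exp_nat_mul, Nat.cast_choose_two]
      congr 2
      push_cast
      ring
    have hAle : A ≤ 80 * (1 + t) * u * Real.exp (l * i / 2 - u) := by
      calc A = Real.exp (l / 2) * Real.exp (l * i / 2) * R := by
            rw [hA, ← Real.exp_add]
            ring_nf
        _ ≤ 10 * Real.exp (l * i / 2) * (8 * (1 + t) * u * Real.exp (-u)) := by gcongr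
        _ = _ := by
            rw [sub_eq_add_neg, Real.exp_add]
            ring
    rw [hpow]
    by_cases hcase : 2 * i ≤ k
    · have hcaseR : 2 * (i : ℝ) ≤ k := by exact_mod_cast hcase
      have hAδ : A ≤ δ := by
        refine hAle.trans (le_trans ?_ h1)
        gcongr
        nlinarith
      calc (k.choose i : ℝ) * A ^ i ≤ (1 + A) ^ k := by
            rw [add_comm, add_pow]
            refine le_trans (le_of_eq ?_) (Finset.single_le_sum
              (f := fun j => A ^ j * 1 ^ (k - j) * (k.choose j : ℝ)) (fun j _ => by positivity) hi)
            simp [mul_comm]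
        _ ≤ Real.exp A ^ k := by
            gcongr
            rw [add_comm]
            exact Real.add_one_le_exp A
        _ = Real.exp (A * k) := by rw [← Real.exp_nat_mul, mul_comm]
        _ ≤ _ := by gcongr
    · have hA1 : 4 * A ≤ 1 := by
        refine le_trans ?_ h2
        have : Real.exp (l * i / 2 - u) ≤ Real.exp (-(a / 2) * u) := by
          gcongr
          nlinarith
        calc 4 * A ≤ 4 * (80 * (1 + t) * u * Real.exp (-(a / 2) * u)) := by
              gcongr
              refine hAle.trans ?_
              gcongr
          _ = _ := by ring
      have hch : (k.choose i : ℝ) ≤ 4 ^ i := by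
        calc (k.choose i : ℝ) ≤ 2 ^ k := by exact_mod_cast Nat.choose_le_two_pow k i
          _ ≤ 2 ^ (2 * i) := pow_le_pow_right₀ (by norm_num) (by omega)
          _ = 4 ^ i := by rw [pow_mul]; norm_num
      calc (k.choose i : ℝ) * A ^ i ≤ 4 ^ i * A ^ i := by gcongr
        _ = (4 * A) ^ i := (mul_pow _ _ _).symm
        _ ≤ 1 := pow_le_one₀ (by positivity) hA1
        _ ≤ _ := Real.one_le_exp (by positivity)
  refine (Finset.sum_le_sum hterm).trans ?_
  rw [Finset.sum_const, Finset.card_range, nsmul_eq_mul]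
  push_cast
  rfl

/-- The first moment bound is exponentially small in `x`. The tilting parameter of the Chernoff bound
is `1 / (x p)`, the reciprocal of the average degree in a set of `x` vertices. -/
theorem choose_mul_pow_le {n x : ℕ} {p l u a : ℝ} (hx : 0 < x) (hn : 0 < n) (hp : 0 < p)
    (hp1 : p < 1) (hq : (1 - p)⁻¹ = Real.exp l) (hl : Real.exp (l / 2) ≤ 10)
    (hu : Real.exp u = n * p) (hxl : (2 + a) * u ≤ x * l)
    (h : 10 * Real.exp 51 * Real.exp (-(a / 2) * u) ≤ Real.exp (-(1 / 2))) :
    (n.choose x : ℝ) * (((x * p)⁻¹ ^ x)⁻¹ * (p * (x * p)⁻¹ + (1 - p)) ^ x.choose 2) ≤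
      Real.exp (-(x / 2)) := by
  have hxR : (0 : ℝ) < x := by exact_mod_cast hx
  have hnR : (0 : ℝ) < n := by exact_mod_cast hn
  have hp1' : 0 < 1 - p := sub_pos.2 hp1
  have hchoose : (n.choose x : ℝ) ≤ (Real.exp 1 * n / x) ^ x := by
    have h1 : (n.choose x : ℝ) ≤ n ^ x / x.factorial := Nat.choose_le_pow_div x n
    have h2 : (x : ℝ) ^ x / x.factorial ≤ Real.exp x := Real.pow_div_factorial_le_exp _ hxR.le x
    calc (n.choose x : ℝ) ≤ n ^ x / x.factorial := h1
      _ = (n / x) ^ x * ((x : ℝ) ^ x / x.factorial) := by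
          rw [div_pow]
          field_simp
      _ ≤ (n / x) ^ x * Real.exp x := by gcongr
      _ = _ := by
          rw [← Real.exp_one_pow, ← mul_pow]
          congr 1
          ring
  have hq100 : Real.exp l ≤ 100 := by
    have : Real.exp l = Real.exp (l / 2) * Real.exp (l / 2) := by rw [← Real.exp_add]; ring_nf
    rw [this]
    nlinarith [Real.exp_pos (l / 2)]
  have h1p : 1 - p = Real.exp (-l) := by rw [Real.exp_neg, ← hq, inv_inv]
  have hbase : p * (x * p)⁻¹ + (1 - p) ≤ Real.exp (100 / x - l) := by
    have e1 : p * (x * p)⁻¹ = 1 / x := by field_simp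
    have e2 : (1 : ℝ) / x ≤ 100 / x * Real.exp (-l) := by
      rw [Real.exp_neg, div_mul_eq_mul_div]
      gcongr
      rw [← div_eq_mul_inv, one_le_div (Real.exp_pos l)]
      exact hq100
    rw [e1, h1p, sub_eq_add_neg, Real.exp_add]
    nlinarith [Real.add_one_le_exp (100 / (x : ℝ)), Real.exp_pos (-l)]
  have hpow : (p * (x * p)⁻¹ + (1 - p)) ^ x.choose 2 ≤
      (Real.exp 50 * Real.exp (l / 2) * Real.exp (-(x * l / 2))) ^ x := by
    calc _ ≤ Real.exp (100 / x - l) ^ x.choose 2 := by gcongr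
      _ = Real.exp ((x * (x - 1) / 2 : ℝ) * (100 / x - l)) := by
          rw [← Real.exp_nat_mul, Nat.cast_choose_two]
      _ ≤ Real.exp (x * (50 + l / 2 + -(x * l / 2))) := by
          apply Real.exp_le_exp.2
          have : (x * (x - 1) / 2 : ℝ) * (100 / x - l) =
            x * (50 + l / 2 + -(x * l / 2)) - 50 := by
            field_simp
            ring
          linarith
      _ = _ := by
          rw [Real.exp_nat_mul, Real.exp_add, Real.exp_add]
  calc _ ≤ (Real.exp 1 * n / x) ^ x * ((x * p) ^ x *
        (Real.exp 50 * Real.exp (l / 2) * Real.exp (-(x * l / 2))) ^ x) := by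
        rw [inv_pow, inv_inv]
        gcongr
    _ = (Real.exp 51 * Real.exp (l / 2) * (n * p) * Real.exp (-(x * l / 2))) ^ x := by
        rw [← mul_pow, ← mul_pow, show (51 : ℝ) = 1 + 50 by norm_num, Real.exp_add]
        congr 1
        field_simp
    _ ≤ Real.exp (-(1 / 2)) ^ x := by
        gcongr
        refine le_trans ?_ h
        have e : Real.exp (-(x * l / 2)) ≤ Real.exp (-u + -(a / 2) * u) := by
          gcongr
          linarith
        calc _ ≤ Real.exp 51 * 10 * (n * p) * Real.exp (-u + -(a / 2) * u) := by gcongr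
          _ = _ := by
            rw [Real.exp_add, ← hu, Real.exp_neg]
            field_simp
    _ = _ := by
        rw [← Real.exp_nat_mul]
        congr 1
        ring

theorem eventually_mul_exp_neg_mul_le (C : ℝ) {c η : ℝ} (hc : 0 < c) (hη : 0 < η) :
    ∀ᶠ u : ℝ in atTop, C * u * Real.exp (-c * u) ≤ η := by
  have h1 := (Real.tendsto_pow_mul_exp_neg_atTop_nhds_zero 1).comp
    (tendsto_id.const_mul_atTop hc)
  have h2 := h1.const_mul (C / c)
  rw [mul_zero] at h2
  filter_upwards [h2.eventually (ge_mem_nhds hη)] with u hu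
  refine le_trans (le_of_eq ?_) hu
  simp only [Function.comp, id, pow_one]
  rw [neg_mul]
  field_simp

theorem eventually_mul_exp_neg_mul_le' (C : ℝ) {c η : ℝ} (hc : 0 < c) (hη : 0 < η) :
    ∀ᶠ u : ℝ in atTop, C * Real.exp (-c * u) ≤ η := by
  filter_upwards [eventually_mul_exp_neg_mul_le |C| hc hη, eventually_ge_atTop 1] with u hu hu1
  refine le_trans ?_ hu
  gcongr
  nlinarith [le_abs_self C, abs_nonneg C]

theorem neg_log_one_sub_bounds {p : ℝ} (hp0 : 0 < p) (hp1 : p ≤ 0.99) :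
    p ≤ -Real.log (1 - p) ∧ -Real.log (1 - p) ≤ 100 * p ∧
      Real.exp (-Real.log (1 - p) / 2) ≤ 10 := by
  have h1 : (0.01 : ℝ) ≤ 1 - p := by linarith
  have h1' : 0 < 1 - p := by linarith
  refine ⟨?_, ?_, ?_⟩
  · linarith [Real.log_le_sub_one_of_pos h1']
  · have := Real.one_sub_inv_le_log_of_pos h1'
    have h2 : (1 - p)⁻¹ ≤ 100 := by
      rw [inv_le_comm₀ h1' (by norm_num)]
      linarith
    have h3 : (1 - p)⁻¹ - 1 = (1 - p)⁻¹ * p := by field_simp; ring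
    nlinarith
  · have h2 : Real.exp (-Real.log (1 - p) / 2) ^ 2 ≤ 10 ^ 2 := by
      rw [← Real.exp_nat_mul]
      have : ((2 : ℕ) : ℝ) * (-Real.log (1 - p) / 2) = -Real.log (1 - p) := by push_cast; ring
      rw [this, Real.exp_neg, Real.exp_log h1', inv_le_comm₀ h1' (by norm_num)]
      linarith
    exact le_of_sq_le_sq h2 (by norm_num)

/-! ### The two tails of the largest order -/

namespace SimpleGraph

variable {W : Type*}

theorem binomialRandom_real_lt_maxInducedTMatchingOrder_le [Finite W] {T : SimpleGraph W}
    (hT : T.IsTree) {n : ℕ} (p : unitInterval) (hn : 0 < n) (hp0 : (0 : ℝ) < p)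
    (hp1 : (p : ℝ) ≤ 0.99) {u L a : ℝ} (hu : Real.exp u = n * p) (hu100 : 100 ≤ u)
    (hL : L * -Real.log (1 - p) = u) (ha : 0 < a)
    (h : 10 * Real.exp 51 * Real.exp (-(a / 2) * u) ≤ Real.exp (-(1 / 2))) :
    (G(Fin n, p)).real {G | (2 + a) * L < maxInducedTMatchingOrder T G} ≤ Real.exp (-(L / 2)) := by
  obtain ⟨hl1, hl2, hl3⟩ := neg_log_one_sub_bounds hp0 hp1
  set l := -Real.log (1 - p) with hl
  have hp1' : (p : ℝ) < 1 := by linarith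
  have hl0 : 0 < l := by linarith
  have hL0 : 0 < L := by
    by_contra hneg
    nlinarith
  set x : ℕ := ⌊(2 + a) * L⌋₊ + 1 with hx
  have hxL : (2 + a) * L < x := by
    rw [hx]
    push_cast
    exact Nat.lt_floor_add_one _
  have hx2 : 2 * L < x := by nlinarith
  have hxR : (0 : ℝ) < x := by linarith
  have hxp : 1 ≤ x * (p : ℝ) := by nlinarith
  calc _ ≤ (G(Fin n, p)).real {G | x ≤ maxInducedTMatchingOrder T G} := by
        refine measureReal_mono ?_ (measure_ne_top _ _)
        intro G hG
        exact Nat.succ_le_of_lt ((Nat.floor_lt (by positivity)).2 hG)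
    _ ≤ _ := binomialRandom_real_le_maxInducedTMatchingOrder_le hT p x (s := (x * (p : ℝ))⁻¹)
        (by positivity) (inv_le_one_of_one_le₀ hxp)
    _ ≤ Real.exp (-(x / 2)) := by
        rw [Fintype.card_fin]
        refine choose_mul_pow_le (Nat.succ_pos _) hn hp0 hp1' ?_ hl3 hu ?_ h
        · rw [hl, Real.exp_neg, Real.exp_log (by linarith)]
        · rw [← hL, ← mul_assoc]
          exact mul_le_mul_of_nonneg_right hxL.le hl0.le
    _ ≤ _ := by
        gcongr
        linarith

theorem binomialRandom_real_maxInducedTMatchingOrder_lt_le_exp [Fintype W] [Nonempty W]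
    {T : SimpleGraph W} (hT : T.IsTree) {n : ℕ} (p : unitInterval) (hn : 0 < n)
    (hp0 : (0 : ℝ) < p) (hp1 : (p : ℝ) ≤ 0.99) {u L a c : ℝ} (hu : Real.exp u = n * p)
    (hu100 : 100 ≤ u) (hL : L * -Real.log (1 - p) = u) (ha : 0 < a) (ha1 : a ≤ 1 / 4)
    (hLa : Fintype.card W ≤ a * L) (hc : c = a ^ 2 / (8 * Fintype.card W ^ 2))
    (h1 : 80 * (1 + Fintype.card W) * u * Real.exp (-(1 / 2) * u) ≤ c)
    (h2 : 320 * (1 + Fintype.card W) * u * Real.exp (-(a / 2) * u) ≤ 1) :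
    (G(Fin n, p)).real {G | (maxInducedTMatchingOrder T G : ℝ) < (2 - 4 * a) * L} ≤
      (1 + 2 / c) * Real.exp (-(c * L / 2)) := by
  obtain ⟨hl1, hl2, hl3⟩ := neg_log_one_sub_bounds hp0 hp1
  set l := -Real.log (1 - p) with hl
  set t := Fintype.card W with ht
  have hp1' : (p : ℝ) < 1 := by linarith
  have hl0 : 0 < l := by linarith
  have hL0 : 0 < L := by
    by_contra hneg
    nlinarith
  have ht0 : 0 < t := Fintype.card_pos
  have htR : (1 : ℝ) ≤ t := by exact_mod_cast ht0
  have hc0 : 0 < c := by rw [hc]; positivity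
  have haL : a * L ≤ 1 / 4 * L := by gcongr
  set m : ℕ := ⌊(2 - a) * L / t⌋₊ with hm
  have hmle : (m : ℝ) * t ≤ (2 - a) * L := by
    rw [← le_div_iff₀ (by linarith)]
    exact Nat.floor_le (div_nonneg (mul_nonneg (by linarith) hL0.le) (by linarith))
  have hmge : (2 - a) * L - t ≤ m * t := by
    have := Nat.lt_floor_add_one ((2 - a) * L / t)
    rw [← hm, div_lt_iff₀ (by linarith)] at this
    linarith
  set k : ℕ := m * t with hk
  have hkR : (k : ℝ) = m * t := by rw [hk]; push_cast; rfl
  have hkL : L ≤ k := by rw [hkR]; linarith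
  have hk0R : (0 : ℝ) < k := by linarith
  have hk0 : 0 < k := by exact_mod_cast hk0R
  have hm0 : 0 < m := Nat.pos_of_mul_pos_right hk0
  have hkl : k * l ≤ (2 - a) * u := by
    rw [hkR, ← hL, ← mul_assoc]
    exact mul_le_mul_of_nonneg_right hmle hl0.le
  have hkp : k * (p : ℝ) ≤ 2 * u := by
    have e1 : k * (p : ℝ) ≤ k * l := by gcongr
    have e2 : 0 ≤ a * u := by positivity
    linarith
  have hkp1 : 1 ≤ k * (p : ℝ) := by
    have e1 : L * (p : ℝ) ≤ k * p := by gcongr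
    have e2 : L * l ≤ L * (100 * p) := by gcongr
    linarith
  have hnR : (0 : ℝ) < n := by exact_mod_cast hn
  have h2k : 2 * k ≤ n := by
    have e1 : 4 * u ≤ n * p := by
      rw [← hu]
      nlinarith [Real.quadratic_le_exp_of_nonneg (by linarith : (0 : ℝ) ≤ u)]
    have e2 : (2 * k : ℝ) * p ≤ n * p := by linarith
    have e3 : (2 * k : ℝ) ≤ n := le_of_mul_le_mul_right e2 hp0
    exact_mod_cast e3
  set N : ℕ := n / (2 * k) with hN
  have hN0 : 0 < N := Nat.div_pos h2k (by omega)
  have hNn : 2 * k * N ≤ n := Nat.mul_div_le n (2 * k)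
  have hnN : (n : ℝ) ≤ 4 * (k * N) := by
    have e1 : n < 2 * k * (N + 1) := Nat.lt_mul_div_succ n (by omega)
    have e2 : k ≤ k * N := Nat.le_mul_of_pos_right k hN0
    have e3 : n ≤ 4 * (k * N) := by
      have e4 : 2 * k * (N + 1) = 2 * (k * N) + 2 * k := by ring
      omega
    exact_mod_cast e3
  -- the block of a vertex is its residue modulo the number of blocks
  let b : Fin (2 * k) × Fin N ↪ Fin n := ⟨fun y => ⟨y.1 + 2 * k * y.2, by
      have e1 := y.1.2
      have e2 : (y.2 : ℕ) + 1 ≤ N := y.2.2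
      calc (y.1 : ℕ) + 2 * k * y.2 < 2 * k * (y.2 + 1) := by linarith
        _ ≤ 2 * k * N := Nat.mul_le_mul_left _ e2
        _ ≤ n := hNn⟩, by
      rintro ⟨y1, y2⟩ ⟨z1, z2⟩ hyz
      have e := Fin.ext_iff.1 hyz
      simp only at e
      have e1 : (y1 : ℕ) = z1 := by
        have := congrArg (· % (2 * k)) e
        simpa [Nat.add_mul_mod_self_left, Nat.mod_eq_of_lt y1.2, Nat.mod_eq_of_lt z1.2] using this
      rw [e1] at e
      have e2 : (y2 : ℕ) = z2 := Nat.eq_of_mul_eq_mul_left (by omega) (Nat.add_left_cancel e)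
      exact Prod.ext (Fin.ext e1) (Fin.ext e2)⟩
  have hB := sum_choose_mul_pow_le (t := t) hk0 hn hp0 hl0.le
    (by rw [hl, Real.exp_neg, Real.exp_log (by linarith)]) hl3 hu hkl hkp hkp1 hnN ha hc0 h1 h2
  have key := binomialRandom_real_maxInducedTMatchingOrder_lt_le hT (k := k) (m := m) (N := N) rfl
    hm0 hN0 b (fun v => v % (2 * k))
    (fun y => (Nat.add_mul_mod_self_left _ _ _).trans (Nat.mod_eq_of_lt y.1.2))
    (fun v => Nat.mod_lt _ (by omega)) p hp0 hp1' (r := a * m) (by positivity)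
    (B := (k + 1) * Real.exp (c * k)) (by positivity) hB
  have hsub : (2 - 4 * a) * L ≤ t * (m - a * m) := by
    have : (t : ℝ) * (m - a * m) = (1 - a) * (m * t) := by ring
    rw [this]
    have e1 : (2 - 2 * a) * L ≤ m * t := by linarith
    have e2 : (1 - a) * ((2 - 2 * a) * L) ≤ (1 - a) * (m * t) :=
      mul_le_mul_of_nonneg_left e1 (by linarith)
    have e3 : 0 ≤ a ^ 2 * L := by positivity
    linarith
  calc _ ≤ (G(Fin n, p)).real {G | (maxInducedTMatchingOrder T G : ℝ) < t * (m - a * m)} := by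
        refine measureReal_mono ?_ (measure_ne_top _ _)
        intro G hG
        exact lt_of_lt_of_le hG hsub
    _ ≤ _ := key
    _ = (k + 1) * Real.exp (-(c * k)) := by
        rw [mul_assoc, ← Real.exp_add]
        congr 2
        rw [hc, hkR]
        have hmR : (0 : ℝ) < m := by exact_mod_cast hm0
        field_simp
        ring
    _ ≤ ((1 + 2 / c) * Real.exp (c * k / 2)) * Real.exp (-(c * k)) := by
        gcongr
        have e1 := Real.add_one_le_exp (c * k / 2)
        have e2 : (1 + 2 / c) * (c * k / 2 + 1) = k + 1 + (c * k / 2 + 2 / c) := by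
          field_simp
          ring
        have e3 : (0 : ℝ) ≤ c * k / 2 + 2 / c := by positivity
        calc (k + 1 : ℝ) ≤ (1 + 2 / c) * (c * k / 2 + 1) := by linarith
          _ ≤ _ := by gcongr
    _ = (1 + 2 / c) * Real.exp (-(c * k / 2)) := by
        rw [mul_assoc, ← Real.exp_add]
        ring_nf
    _ ≤ _ := by gcongr

end SimpleGraph

theorem theorem1p2 (ε : ℝ) (hε : 0 < ε) {W : Type*} [Finite W] (T : SimpleGraph W)
    (hT : T.IsTree) :
    ∃ d₀ : ℝ, 0 < d₀ ∧
      ∀ p : ℕ → unitInterval,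
        (∀ᶠ n : ℕ in atTop, d₀ / (n : ℝ) ≤ (p n : ℝ) ∧ (p n : ℝ) ≤ 0.99) →
        Tendsto
          (fun n : ℕ => (G(Fin n, p n)).real
            {G : SimpleGraph (Fin n) |
              (2 - ε) * Real.logb (1 / (1 - (p n : ℝ))) ((n : ℝ) * (p n : ℝ)) ≤
                  (SimpleGraph.maxInducedTMatchingOrder T G : ℝ) ∧
                (SimpleGraph.maxInducedTMatchingOrder T G : ℝ) ≤
                  (2 + ε) * Real.logb (1 / (1 - (p n : ℝ))) ((n : ℝ) * (p n : ℝ))})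
          atTop (𝓝 1) := by
  classical
  have : Fintype W := Fintype.ofFinite W
  have : Nonempty W := hT.connected.nonempty
  set t := Fintype.card W with ht
  have htR : (0 : ℝ) < t := by exact_mod_cast Fintype.card_pos (α := W)
  set a : ℝ := min ε 1 / 4 with ha
  have ha0 : 0 < a := by positivity
  have ha1 : a ≤ 1 / 4 := by
    have := min_le_right ε 1
    linarith
  have haε : 4 * a ≤ ε := by
    have := min_le_left ε 1
    linarith
  set c : ℝ := a ^ 2 / (8 * t ^ 2) with hc
  have hc0 : 0 < c := by positivity
  obtain ⟨U, hU⟩ := eventually_atTop.1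
    ((eventually_mul_exp_neg_mul_le (80 * (1 + t)) (c := 1 / 2) (by norm_num) hc0).and
    ((eventually_mul_exp_neg_mul_le (320 * (1 + t)) (c := a / 2) (by positivity) one_pos).and
    ((eventually_mul_exp_neg_mul_le' (10 * Real.exp 51) (c := ε / 2) (by positivity)
      (Real.exp_pos (-(1 / 2)))).and (eventually_ge_atTop 100))))
  refine ⟨Real.exp U, Real.exp_pos U, fun p hp => ?_⟩
  -- the probability of failure is at most a negative power of `n`
  set E : ℕ → ℝ := fun n => (1 + 2 / c) * Real.exp (-(c * (Real.log n / 100) / 2)) +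
    Real.exp (-(Real.log n / 100 / 2)) with hE
  have hlog : Tendsto (fun n : ℕ => Real.log n) atTop atTop :=
    Real.tendsto_log_atTop.comp tendsto_natCast_atTop_atTop
  have hElim : Tendsto (fun n => 1 - E n) atTop (𝓝 1) := by
    have e : ∀ y : ℝ, 0 < y → Tendsto (fun n : ℕ => Real.exp (-(y * Real.log n))) atTop (𝓝 0) :=
      fun y hy => Real.tendsto_exp_neg_atTop_nhds_zero.comp (hlog.const_mul_atTop hy)
    have e1 := ((e (c / 200) (by positivity)).const_mul (1 + 2 / c)).add
      (e (1 / 200) (by positivity))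
    have e2 := e1.const_sub 1
    simp only [mul_zero, add_zero, sub_zero] at e2
    refine e2.congr fun n => ?_
    simp only [hE]
    congr 4 <;> ring_nf
  refine tendsto_of_tendsto_of_tendsto_of_le_of_le' hElim tendsto_const_nhds ?_
    (Eventually.of_forall fun n => measureReal_le_one)
  filter_upwards [hp, eventually_gt_atTop 0, hlog.eventually_ge_atTop (100 * (t / a))]
    with n hpn hn hlogn
  obtain ⟨hpd, hp1⟩ := hpn
  have hnR : (0 : ℝ) < n := by exact_mod_cast hn
  have hnp : Real.exp U ≤ n * p n := by
    rw [div_le_iff₀ hnR] at hpd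
    linarith
  have hnp0 : 0 < n * (p n : ℝ) := (Real.exp_pos U).trans_le hnp
  have hp0 : (0 : ℝ) < p n := pos_of_mul_pos_right hnp0 hnR.le
  set u := Real.log (n * p n) with hu
  have huU : U ≤ u := (Real.le_log_iff_exp_le hnp0).2 hnp
  obtain ⟨h1, h2, h3, h4⟩ := hU u huU
  have hexp : Real.exp u = n * p n := Real.exp_log hnp0
  obtain ⟨hl1, hl2, hl3⟩ := neg_log_one_sub_bounds hp0 hp1
  have hl0 : 0 < -Real.log (1 - p n) := by linarith
  set L := Real.logb (1 / (1 - (p n : ℝ))) (n * p n) with hL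
  have hLu : L * -Real.log (1 - p n) = u := by
    rw [hL, Real.logb, one_div, Real.log_inv, div_mul_cancel₀ _ hl0.ne']
  -- `log y / y` is decreasing, so `L` is smallest when `p` is largest
  have hLlog : Real.log n / 100 ≤ L := by
    have hanti := Real.log_div_self_antitoneOn (a := n * p n) (b := n)
      (by
        rw [Set.mem_Ici, ← hexp]
        exact Real.exp_le_exp.2 (by linarith))
      (by
        have : Real.exp 1 ≤ n * p n := by
          rw [← hexp]
          exact Real.exp_le_exp.2 (by linarith)
        exact this.trans (mul_le_of_le_one_right hnR.le (p n).2.2))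
      (mul_le_of_le_one_right hnR.le (p n).2.2)
    simp only [← hu] at hanti
    rw [div_le_div_iff₀ hnR hnp0] at hanti
    have e1 : Real.log n * p n ≤ u := by
      have : (Real.log n * p n) * n ≤ u * n := by linarith
      exact le_of_mul_le_mul_right this hnR
    have e2 : u ≤ L * (100 * p n) := by
      rw [← hLu]
      have hL0 : 0 < L := by
        by_contra hneg
        nlinarith
      gcongr
    have e3 : Real.log n * p n ≤ (L * 100) * p n := by linarith
    have := le_of_mul_le_mul_right e3 hp0
    linarith
  have hLa : t ≤ a * L := by
    have : t / a ≤ L := by linarith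
    rw [div_le_iff₀ ha0] at this
    linarith
  have hL0 : 0 ≤ L := by
    by_contra hneg
    nlinarith
  have low := SimpleGraph.binomialRandom_real_maxInducedTMatchingOrder_lt_le_exp hT (p n) hn hp0 hp1
    hexp h4 hLu ha0 ha1 hLa hc h1 h2
  have up := SimpleGraph.binomialRandom_real_lt_maxInducedTMatchingOrder_le hT (p n) hn hp0 hp1
    hexp h4 hLu hε h3
  set S := {G : SimpleGraph (Fin n) | (2 - ε) * L ≤ (SimpleGraph.maxInducedTMatchingOrder T G : ℝ) ∧
    (SimpleGraph.maxInducedTMatchingOrder T G : ℝ) ≤ (2 + ε) * L} with hS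
  have hcompl : (G(Fin n, p n)).real Sᶜ ≤ E n := by
    calc _ ≤ (G(Fin n, p n)).real
          ({G | (SimpleGraph.maxInducedTMatchingOrder T G : ℝ) < (2 - 4 * a) * L} ∪
            {G | (2 + ε) * L < SimpleGraph.maxInducedTMatchingOrder T G}) := by
          refine measureReal_mono ?_ (measure_ne_top _ _)
          intro G hG
          by_contra hG'
          simp only [Set.mem_union, Set.mem_ofPred_eq, not_or, not_lt] at hG'
          refine hG ⟨le_trans ?_ hG'.1, hG'.2⟩
          gcongr
      _ ≤ _ := measureReal_union_le _ _
      _ ≤ _ := add_le_add low up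
      _ ≤ E n := by
          simp only [hE]
          gcongr
  have hadd := probReal_add_probReal_compl (μ := G(Fin n, p n)) (s := S) MeasurableSet.of_discrete
  linarith
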